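/- **Setting.** All parameters are functions of $p\to\infty$. Let $n,s_0,r\in\mathbb N$, $\epsilon>0$, $\delta\in(0,1)$. Let $\mathcal D$ be a fixed probability distribution on $[-b,b]$ with mean $0$ and variance $1$, let $\sigma>0$ with $\sigma=\Theta(1)$, and let $b_n$ satisfy $b_n=O(\sigma\sqrt{\log n})$ and $b_n/\sigma-\sqrt{2\log(2n)}\to\infty$. Let $\theta_0\in\mathbb R^p$ have exactly $s_0$ non-zero entries and $\|\theta_0\|_2=1$. Let $X\in\mathbb R^{n\times p}$ have entries of law $\mathcal D$, let $\xi\in\mathbb R^n$ have entries distributed as $\mathcal N(0,\sigma^2)$ conditioned on $[-b_n,b_n]$, and let $R=[R_1\,R_2\,R_3]\in\mathbb R^{r\times(n+p+1)}$ have entries of law $\mathcal N(0,1/r)$, all these entries being mutually independent. Put $y=X\theta_0+\xi$ and $$B^2=2pb^2+(b\sqrt{s_0}+b_n)^2,\qquad w^2=\frac{4B^2}{\epsilon}\Big(\sqrt{2r\log(4/\delta)}+\log(4/\delta)\Big),\quad w\ge 0,\qquad [X^*\ y^*]=R\begin{bmatrix}X\ \ y\\ wI_{p+1}\end{bmatrix}.$$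 For a constant $C_\lambda>0$ put $$\lambda=C_\lambda\,\sigma\max\Big\{\sqrt{\tfrac{\log p}{n}},\sqrt{\tfrac{(\log p)^3}{r}}\Big\},\quad \rho_n^2=\frac{n+r+1}{nr}+\frac{w^2}{nr},\quad \phi_w=1+\frac{w^2}{n},\quad \kappa_n=2\lambda\sqrt{s_0}+\frac{w^2}{n},$$ let $\widehat\theta^*$ be a minimizer over $\theta\in\mathbb R^p$ of $\frac1{2n}\|X^*\theta-y^*\|_2^2+\lambda\|\theta\|_1$, and let $$\Delta=\Big(\tfrac1nX^\top X-I_p\Big)(\theta_0-\widehat\theta^*)+\tfrac1n[X^\top\ wI_p\ \mathbf 0]\,(R^\top R-I_{n+p+1})\begin{bmatrix}X(\theta_0-\widehat\theta^*)\\-w\widehat\theta^*\\ w\end{bmatrix}$$ be the bias term of the debiased private Lasso. **Statement.** There is an absolute constant $C_\lambda>0$ such that the following holds. Let $c_0\in(0,1)$, $\alpha>2$, $\alpha+\gamma>3$, let $n=p^\alpha$ and $s_0=c_0p$ (up to rounding to an integer, i.e. up to an error of at most $1$), let $\epsilon=p^\gamma$ and $\log(1/\delta)=O(\log p)$. Then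 there is a choice of $r=r(p)\to\infty$, depending only on these parameters (and not on $\mathcal D,b,\sigma,b_n,\theta_0$), such that for all $\mathcal D,b,\sigma,b_n$ as above the four conditions 1. $\dfrac{\kappa_n^2}{\lambda^2\phi_w}=o\Big(\sqrt{\tfrac{n}{\log p}}\,\min\big\{1,\sqrt{\tfrac rn},\tfrac{\sqrt{rn}}{w^2}\big\}\Big)$, 2. $\sqrt{s_0}=O\Big(\max\big\{\tfrac1{\sqrt n},\tfrac{\log p}{\sqrt r}\big\}\Big/\max\big\{\tfrac{w\log p}{\sqrt{nr}},\tfrac{w^2}{n}\sqrt{\tfrac{\log p}{r}}\big\}\Big)$, 3. $\dfrac{\sqrt{s_0}}{\sigma\rho_n}=o\Big(\min\big\{\tfrac n{w^2}\sqrt{\tfrac r{\log p}},\tfrac{\sqrt{nr}}{w\log p}\big\}\Big)$, 4. $\dfrac{1}{\sigma\rho_n}\dfrac{4\kappa_n^2}{\lambda\phi_w}=o\Big(\min\big\{\sqrt{\tfrac n{\log p}},\sqrt{\tfrac r{\log p}},\tfrac n{w^2}\sqrt{\tfrac r{\log p}},\tfrac{\sqrt{nr}}{w\log p}\big\}\Big)$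 hold as $p\to\infty$, and moreover, for every sequence $\theta_0$ as above and every choice of the minimizers $\widehat\theta^*$, $\|\Delta\|_\infty=o_p(\sigma\rho_n)$, that is, $\lim_{p\to\infty}\mathbb P\big(\|\Delta\|_\infty/(\sigma\rho_n)>\eta\big)=0$ for every $\eta>0$. -/

import Mathlib

open MeasureTheory ProbabilityTheory Filter Asymptotics
open scoped Topology NNReal

noncomputable section

namespace JLDebias

/-! ### Scalar parameters -/

/-- The bound `B` on the Euclidean norm of the data rows. -/
def rowBound (p s₀ : ℕ) (b bn : ℝ) : ℝ :=
  √(2 * p * b ^ 2 + (b * √(s₀ : ℝ) + bn) ^ 2)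

/-- The privacy parameter `w`,
with `w² = (4 B² / ε) (√(2 r log (4/δ)) + log (4/δ))`. -/
def privacyW (B ε δ : ℝ) (r : ℕ) : ℝ :=
  √(4 * B ^ 2 / ε * (√(2 * r * Real.log (4 / δ)) + Real.log (4 / δ)))

/-- The noise level `ρ`, with `ρ² = (n + r + 1) / (n r) + w² / (n r)`. -/
def rho (n r : ℕ) (w : ℝ) : ℝ :=
  √(((n : ℝ) + r + 1) / (n * r) + w ^ 2 / (n * r))

/-- The Lasso penalty `λ = C σ max {√(log p / n), √((log p)³ / r)}`. -/
def penalty (C σ : ℝ) (n p r : ℕ) : ℝ :=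
  C * σ * max √(Real.log p / n) √(Real.log p ^ 3 / r)

/-- `φ_w = 1 + w² / n`. -/
def phiW (n : ℕ) (w : ℝ) : ℝ := 1 + w ^ 2 / n

/-- `κ = 2 λ √s₀ + w² / n`. -/
def kappa (lam : ℝ) (n s₀ : ℕ) (w : ℝ) : ℝ := 2 * lam * √(s₀ : ℝ) + w ^ 2 / n

/-! ### Private data, private Lasso, bias term

The columns of the projection matrix `R` are indexed by `Fin n ⊕ (Fin p ⊕ Unit)`, which is the
split `R = [R₁ R₂ R₃]`. -/

/-- The privatized data `[X* y*] = R [X y; w I_{p+1}]`. -/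
def privateData {n p r : ℕ} (w : ℝ) (X : Matrix (Fin n) (Fin p) ℝ) (y : Fin n → ℝ)
    (R : Matrix (Fin r) (Fin n ⊕ (Fin p ⊕ Unit)) ℝ) : Matrix (Fin r) (Fin p ⊕ Unit) ℝ :=
  R * Matrix.fromRows (Matrix.fromCols X (Matrix.replicateCol Unit y))
    (w • (1 : Matrix (Fin p ⊕ Unit) (Fin p ⊕ Unit) ℝ))

/-- The private design matrix `X*`. -/
def privateX {n p r : ℕ} (w : ℝ) (X : Matrix (Fin n) (Fin p) ℝ) (y : Fin n → ℝ)
    (R : Matrix (Fin r) (Fin n ⊕ (Fin p ⊕ Unit)) ℝ) : Matrix (Fin r) (Fin p) ℝ :=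
  (privateData w X y R).toCols₁

/-- The private response `y*`. -/
def privateY {n p r : ℕ} (w : ℝ) (X : Matrix (Fin n) (Fin p) ℝ) (y : Fin n → ℝ)
    (R : Matrix (Fin r) (Fin n ⊕ (Fin p ⊕ Unit)) ℝ) : Fin r → ℝ :=
  fun k => privateData w X y R k (Sum.inr ())

/-- The objective `(1 / 2n) ‖A θ - v‖₂² + λ ‖θ‖₁`. -/
def lassoObjective {p r : ℕ} (n : ℕ) (lam : ℝ) (A : Matrix (Fin r) (Fin p) ℝ)
    (v : Fin r → ℝ) (θ : Fin p → ℝ) : ℝ :=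
  1 / (2 * n) * ∑ k, (A.mulVec θ k - v k) ^ 2 + lam * ∑ j, |θ j|

/-- `θ` is a private Lasso estimate: a minimizer of the Lasso objective of `(X*, y*)`. -/
def IsPrivateLasso {n p r : ℕ} (lam w : ℝ) (X : Matrix (Fin n) (Fin p) ℝ) (y : Fin n → ℝ)
    (R : Matrix (Fin r) (Fin n ⊕ (Fin p ⊕ Unit)) ℝ) (θ : Fin p → ℝ) : Prop :=
  ∀ θ' : Fin p → ℝ, lassoObjective n lam (privateX w X y R) (privateY w X y R) θ ≤
    lassoObjective n lam (privateX w X y R) (privateY w X y R) θ'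

/-- The augmented design `[X; w I_p; 0]`. -/
def augmentedDesign {n p : ℕ} (w : ℝ) (X : Matrix (Fin n) (Fin p) ℝ) :
    Matrix (Fin n ⊕ (Fin p ⊕ Unit)) (Fin p) ℝ :=
  Matrix.fromRows X
    (Matrix.fromRows (w • (1 : Matrix (Fin p) (Fin p) ℝ)) (0 : Matrix Unit (Fin p) ℝ))

/-- The bias term
`Δ = (XᵀX/n - I)(θ₀ - θ) + (1/n) [Xᵀ wI 0] (RᵀR - I) [X(θ₀ - θ); -wθ; w]`. -/
def bias {n p r : ℕ} (w : ℝ) (X : Matrix (Fin n) (Fin p) ℝ)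
    (R : Matrix (Fin r) (Fin n ⊕ (Fin p ⊕ Unit)) ℝ) (θ₀ θ : Fin p → ℝ) : Fin p → ℝ :=
  Matrix.mulVec ((1 / (n : ℝ)) • (X.transpose * X) - (1 : Matrix (Fin p) (Fin p) ℝ)) (θ₀ - θ) +
    (1 / (n : ℝ)) •
      Matrix.mulVec (augmentedDesign w X).transpose
        (Matrix.mulVec
          (R.transpose * R -
            (1 : Matrix (Fin n ⊕ (Fin p ⊕ Unit)) (Fin n ⊕ (Fin p ⊕ Unit)) ℝ))
          (Sum.elim (X.mulVec (θ₀ - θ)) (Sum.elim (-(w • θ)) (fun _ : Unit => w))))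

/-! ### The random model -/

/-- The law of `N(0, σ²)` conditioned on `[-a, a]`. -/
def truncatedGaussian (σ a : ℝ) : Measure ℝ :=
  ProbabilityTheory.cond (gaussianReal 0 (Real.toNNReal (σ ^ 2))) (Set.Icc (-a) a)

/-- The random design `X`, the noise `ξ` and the projection matrix `R` have mutually independent
entries, with laws `D`, truncated Gaussian, and `N(0, 1/r)` respectively. -/
structure IsModel {Ω : Type*} [MeasurableSpace Ω] (μ : Measure Ω) {n p r : ℕ}
    (D : Measure ℝ) (σ bn : ℝ) (X : Ω → Matrix (Fin n) (Fin p) ℝ) (ξ : Ω → Fin n → ℝ)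
    (R : Ω → Matrix (Fin r) (Fin n ⊕ (Fin p ⊕ Unit)) ℝ) : Prop where
  law_X : ∀ i j, HasLaw (fun ω => X ω i j) D μ
  law_ξ : ∀ i, HasLaw (fun ω => ξ ω i) (truncatedGaussian σ bn) μ
  law_R : ∀ k l, HasLaw (fun ω => R ω k l) (gaussianReal 0 (1 / (r : ℝ≥0))) μ
  indep : iIndepFun
    (Sum.elim (fun (ij : Fin n × Fin p) ω => X ω ij.1 ij.2)
      (Sum.elim (fun (i : Fin n) ω => ξ ω i)
        (fun (kl : Fin r × (Fin n ⊕ (Fin p ⊕ Unit))) ω => R ω kl.1 kl.2))) μ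

/-! ### The sufficient conditions for debiasing, for sequences indexed by `p` -/

/-- The four growth conditions on the parameters, as `p → ∞`. -/
structure SufficientConditions (C : ℝ) (σ : ℕ → ℝ) (n s₀ r : ℕ → ℕ) (w : ℕ → ℝ) : Prop where
  compatibility :
    (fun p : ℕ => kappa (penalty C (σ p) (n p) p (r p)) (n p) (s₀ p) (w p) ^ 2 /
        (penalty C (σ p) (n p) p (r p) ^ 2 * phiW (n p) (w p)))
      =o[atTop] fun p : ℕ => √((n p : ℝ) / Real.log p) *
        min 1 (min √((r p : ℝ) / n p) (√((r p : ℝ) * n p) / w p ^ 2))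
  penalty_level :
    (fun p : ℕ => √(s₀ p : ℝ))
      =O[atTop] fun p : ℕ => max (1 / √(n p : ℝ)) (Real.log p / √(r p : ℝ)) /
        max (w p * Real.log p / √((n p : ℝ) * r p))
          (w p ^ 2 / n p * √(Real.log p / r p))
  sparsity :
    (fun p : ℕ => 1 / (σ p * rho (n p) (r p) (w p)) * √(s₀ p : ℝ))
      =o[atTop] fun p : ℕ => min ((n p : ℝ) / w p ^ 2 * √((r p : ℝ) / Real.log p))
        (√((n p : ℝ) * r p) / (w p * Real.log p))
  error :
    (fun p : ℕ => 1 / (σ p * rho (n p) (r p) (w p)) *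
        (4 * kappa (penalty C (σ p) (n p) p (r p)) (n p) (s₀ p) (w p) ^ 2 /
          (penalty C (σ p) (n p) p (r p) * phiW (n p) (w p))))
      =o[atTop] fun p : ℕ => min √((n p : ℝ) / Real.log p)
        (min √((r p : ℝ) / Real.log p)
          (min ((n p : ℝ) / w p ^ 2 * √((r p : ℝ) / Real.log p))
            (√((n p : ℝ) * r p) / (w p * Real.log p))))

end JLDebias

end

/-!
The Lasso error `h = θ₀ - θ` is controlled through `‖h‖₁ ≤ √p ‖h‖₂` alone. What makes this possible
is a projection dimension `r = p ^ (2 + τ)` above `p ^ 2` and below `n`. With high probability every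
entry of the private Gram matrix `X*ᵀ X* / n` minus `φ_w I` is then `O(log p / √r)`, by Hoeffding's
inequality for the design and by the Johnson-Lindenstrauss property and polarization for the
projection. As `p log p / √r` tends to `0`, the quadratic form of the private Gram matrix exceeds
`‖h‖₂ ^ 2 / 2`, and the basic inequality of the Lasso gives `‖h‖₁ = O(p (log p) ^ 2 / √r)`.
Multiplying by the entrywise defect, the bias is of order `p (log p) ^ 3 / r = o(1 / √r)`, whereas
`ρ ≥ 1 / √r`.

The privacy noise has `w ^ 2 = O(√r p log p / p ^ γ)`, so that
`√r w ^ 2 / n = O(p ^ (3 + τ - α - γ) log p)` tends to `0` for small `τ`: this is where `α + γ > 3`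
enters, and it makes all terms involving `w` negligible, both in the bias and in the four
conditions.
-/

namespace JLDebias

open scoped Matrix

/-! ### Concentration inequalities -/

section GaussianSquare

lemma integral_exp_mul_sq_gaussianReal (v : ℝ≥0) {s : ℝ} (hs : 2 * s * v < 1) :
    ∫ x, Real.exp (s * x ^ 2) ∂(gaussianReal 0 v) = (√(1 - 2 * s * v))⁻¹ := by
  rcases eq_or_ne v 0 with rfl | hv
  · simp
  have : (0 : ℝ) < v := by positivity
  have density_mul (x : ℝ) : gaussianPDFReal 0 v x • Real.exp (s * x ^ 2)
      = (√(2 * Real.pi * v))⁻¹ * Real.exp (-((1 - 2 * s * v) / (2 * v)) * x ^ 2) := by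
    rw [gaussianPDFReal, smul_eq_mul, mul_assoc, ← Real.exp_add]
    congr 2
    field_simp
    ring
  simp_rw [integral_gaussianReal_eq_integral_smul hv, density_mul]
  rw [integral_const_mul, integral_gaussian, ← Real.sqrt_inv, ← Real.sqrt_inv,
    ← Real.sqrt_mul (by positivity)]
  have : 1 - 2 * s * (v : ℝ) ≠ 0 := by linarith
  congr 1
  field_simp

lemma integrable_exp_mul_sq_gaussianReal (v : ℝ≥0) {s : ℝ} (hs : 2 * s * v < 1) :
    Integrable (fun x => Real.exp (s * x ^ 2)) (gaussianReal 0 v) := by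
  refine .of_integral_ne_zero ?_
  have : 0 < 1 - 2 * s * (v : ℝ) := by linarith
  rw [integral_exp_mul_sq_gaussianReal v hs]
  positivity

lemma inv_sqrt_one_sub_two_mul_le_exp {y : ℝ} (hy : |y| ≤ 1 / 4) :
    (√(1 - 2 * y))⁻¹ ≤ Real.exp (y + 4 * y ^ 2) := by
  have hy₂ : |2 * y| ≤ 1 / 2 := by rw [abs_mul, abs_two]; linarith
  have hpos : 0 < 1 - 2 * y := by linarith [(abs_le.1 hy).2]
  have log_taylor : |2 * y + Real.log (1 - 2 * y)| ≤ (2 * y) ^ 2 / (1 - |2 * y|) := by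
    simpa only [Finset.range_one, Finset.sum_singleton, Nat.cast_zero, zero_add, pow_one, div_one,
      Nat.reduceAdd, sq_abs] using Real.abs_log_sub_add_sum_range_le (x := 2 * y) (by linarith) 1
  have remainder_le : (2 * y) ^ 2 / (1 - |2 * y|) ≤ 8 * y ^ 2 := by
    rw [div_le_iff₀ (by linarith)]
    nlinarith [sq_nonneg y]
  rw [← Real.exp_log (Real.sqrt_pos.2 hpos), ← Real.exp_neg, Real.log_sqrt hpos.le,
    Real.exp_le_exp]
  linarith [(abs_le.1 (log_taylor.trans remainder_le)).1]

lemma exp_mul_sq_sub (s v x : ℝ) :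
    Real.exp (s * (x ^ 2 - v)) = Real.exp (-(s * v)) * Real.exp (s * x ^ 2) := by
  rw [← Real.exp_add]
  ring_nf

lemma integral_exp_mul_sq_sub_gaussianReal_le (v : ℝ≥0) {s : ℝ} (hs : |s * v| ≤ 1 / 4) :
    ∫ x, Real.exp (s * (x ^ 2 - v)) ∂(gaussianReal 0 v) ≤ Real.exp (4 * (s * v) ^ 2) := by
  simp_rw [exp_mul_sq_sub s v]
  rw [integral_const_mul, integral_exp_mul_sq_gaussianReal v (by linarith [(abs_le.1 hs).2]),
    mul_assoc 2]
  calc Real.exp (-(s * v)) * (√(1 - 2 * (s * v)))⁻¹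
      ≤ Real.exp (-(s * v)) * Real.exp (s * v + 4 * (s * v) ^ 2) := by
        gcongr
        exact inv_sqrt_one_sub_two_mul_le_exp hs
    _ = Real.exp (4 * (s * v) ^ 2) := by rw [← Real.exp_add]; ring_nf

variable {Ω : Type*} [MeasurableSpace Ω] {μ : Measure Ω}

lemma mgf_sq_sub_le {g : Ω → ℝ} {v : ℝ≥0} (hg : HasLaw g (gaussianReal 0 v) μ)
    {s : ℝ} (hs : |s * v| ≤ 1 / 4) :
    mgf (fun ω => g ω ^ 2 - v) μ s ≤ Real.exp (4 * (s * v) ^ 2) :=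
  (hg.integral_comp (f := fun x => Real.exp (s * (x ^ 2 - v))) (by fun_prop)).trans_le
    (integral_exp_mul_sq_sub_gaussianReal_le v hs)

lemma integrable_exp_mul_sq_sub {g : Ω → ℝ} {v : ℝ≥0} (hg : HasLaw g (gaussianReal 0 v) μ)
    {s : ℝ} (hs : 2 * s * v < 1) :
    Integrable (fun ω => Real.exp (s * (g ω ^ 2 - v))) μ := by
  have h : Integrable (fun x => Real.exp (s * (x ^ 2 - v))) (μ.map g) := by
    simp_rw [hg.map_eq, exp_mul_sq_sub s v]
    exact (integrable_exp_mul_sq_gaussianReal v hs).const_mul _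
  exact h.comp_aemeasurable hg.aemeasurable

lemma measureReal_lt_abs_le_add [IsFiniteMeasure μ] (Z : Ω → ℝ) (x : ℝ) :
    μ.real {ω | x < |Z ω|} ≤ μ.real {ω | x ≤ Z ω} + μ.real {ω | x ≤ -Z ω} :=
  calc μ.real {ω | x < |Z ω|} ≤ μ.real ({ω | x ≤ Z ω} ∪ {ω | x ≤ -Z ω}) :=
        measureReal_mono fun ω (hω : x < |Z ω|) => (lt_abs.1 hω).imp le_of_lt le_of_lt
    _ ≤ _ := measureReal_union_le _ _

lemma measureReal_lt_abs_le_of_mgf_le [IsFiniteMeasure μ] {Z : Ω → ℝ} {s x M : ℝ} (hs : 0 ≤ s)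
    (hint : ∀ t, |t| = s → Integrable (fun ω => Real.exp (t * Z ω)) μ)
    (hmgf : ∀ t, |t| = s → mgf Z μ t ≤ M) :
    μ.real {ω | x < |Z ω|} ≤ 2 * (Real.exp (-s * x) * M) := by
  have upper : μ.real {ω | x ≤ Z ω} ≤ Real.exp (-s * x) * M :=
    (measure_ge_le_exp_mul_mgf x hs (hint s (abs_of_nonneg hs))).trans <| by
      gcongr; exact hmgf s (abs_of_nonneg hs)
  have hs' : |-s| = s := by rw [abs_neg, abs_of_nonneg hs]
  have lower : μ.real {ω | x ≤ -Z ω} ≤ Real.exp (-s * x) * M := by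
    simp_rw [le_neg (a := x)]
    refine (measure_le_le_exp_mul_mgf (-x) (neg_nonpos.2 hs) (hint (-s) hs')).trans ?_
    rw [neg_mul_neg]
    gcongr
    exact hmgf (-s) hs'
  linarith [measureReal_lt_abs_le_add (μ := μ) Z x]

variable {ι : Type*} [Fintype ι]

lemma mgf_sum_sq_sub_le {g : ι → Ω → ℝ} {v : ℝ≥0} (hind : iIndepFun g μ)
    (hg : ∀ i, HasLaw (g i) (gaussianReal 0 v) μ) {s : ℝ} (hs : |s * v| ≤ 1 / 4) :
    mgf (∑ i, fun ω => g i ω ^ 2 - v) μ s ≤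
      Real.exp (Fintype.card ι * (4 * (s * v) ^ 2)) := by
  have hind_sq : iIndepFun (fun i ω => g i ω ^ 2 - v) μ :=
    hind.comp (fun _ x => x ^ 2 - v) (by fun_prop)
  rw [hind_sq.mgf_sum₀ fun i => ((hg i).aemeasurable.pow_const 2).sub_const _]
  calc ∏ i, mgf (fun ω => g i ω ^ 2 - v) μ s ≤ ∏ _i : ι, Real.exp (4 * (s * v) ^ 2) :=
        Finset.prod_le_prod (fun i _ => mgf_nonneg) fun i _ => mgf_sq_sub_le (hg i) hs
    _ = _ := by rw [Finset.prod_const, Finset.card_univ, ← Real.exp_nat_mul]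

/-- The Chernoff bound is taken at `s = t / (8 v)`. -/
lemma measureReal_lt_abs_sum_sq_sub_le {g : ι → Ω → ℝ} {v : ℝ≥0} (hv : v ≠ 0)
    (hind : iIndepFun g μ) (hm : ∀ i, Measurable (g i))
    (hg : ∀ i, HasLaw (g i) (gaussianReal 0 v) μ) {t : ℝ} (ht₀ : 0 ≤ t) (ht₁ : t ≤ 1) :
    μ.real {ω | t * (Fintype.card ι * v) < |∑ i, (g i ω ^ 2 - v)|}
      ≤ 2 * Real.exp (-(Fintype.card ι * t ^ 2 / 16)) := by
  have := hind.isProbabilityMeasure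
  set N : ℝ := (Fintype.card ι : ℝ)
  have hv₀ : (0 : ℝ) < v := by positivity
  have hs₀ : 0 ≤ t / (8 * v) := by positivity
  have abs_mul_eq (s : ℝ) (hs : |s| = t / (8 * v)) : |s * v| = t / 8 := by
    rw [abs_mul, hs, abs_of_pos hv₀]
    field_simp
  have hind_sq : iIndepFun (fun i ω => g i ω ^ 2 - v) μ :=
    hind.comp (fun _ x => x ^ 2 - v) (by fun_prop)
  have hint (s : ℝ) (hs : |s| = t / (8 * v)) :
      Integrable (fun ω => Real.exp (s * (∑ i, fun ω => g i ω ^ 2 - (v : ℝ)) ω)) μ :=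
    hind_sq.integrable_exp_mul_sum (by fun_prop) fun i _ => integrable_exp_mul_sq_sub (hg i)
      (by linarith [le_abs_self (s * v), abs_mul_eq s hs])
  have hmgf (s : ℝ) (hs : |s| = t / (8 * v)) :
      mgf (∑ i, fun ω => g i ω ^ 2 - (v : ℝ)) μ s ≤ Real.exp (N * (4 * (t / 8) ^ 2)) := by
    rw [← abs_mul_eq s hs, sq_abs]
    exact mgf_sum_sq_sub_le hind hg (by linarith [abs_mul_eq s hs])
  have chernoff := measureReal_lt_abs_le_of_mgf_le (x := t * (N * v)) hs₀ hint hmgf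
  simp only [Finset.sum_apply, ← Real.exp_add] at chernoff
  convert chernoff using 3
  field_simp
  ring

end GaussianSquare

lemma measureReal_lt_abs_sum_le {Ω ι : Type*} [MeasurableSpace Ω] {μ : Measure Ω} [Fintype ι]
    [Nonempty ι] {Y : ι → Ω → ℝ} (hind : iIndepFun Y μ) (hm : ∀ i, AEMeasurable (Y i) μ)
    {c ℓ : ℝ} (hc : 0 < c) (hℓ : 0 ≤ ℓ) (hb : ∀ i, ∀ᵐ ω ∂μ, |Y i ω| ≤ c)
    (h₀ : ∀ i, ∫ ω, Y i ω ∂μ = 0) :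
    μ.real {ω | c * ℓ * √(Fintype.card ι) < |∑ i, Y i ω|} ≤ 2 * Real.exp (-(ℓ ^ 2 / 2)) := by
  have := hind.isProbabilityMeasure
  have subgaussian (i : ι) : HasSubgaussianMGF (Y i) ((‖c - -c‖₊ / 2) ^ 2) μ :=
    hasSubgaussianMGF_of_mem_Icc_of_integral_eq_zero (hm i)
      ((hb i).mono fun ω hω => abs_le.1 hω) (h₀ i)
  have hι : (0 : ℝ) < Fintype.card ι := by exact_mod_cast Fintype.card_pos
  have hx : 0 ≤ c * ℓ * √(Fintype.card ι) := by positivity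
  have hcoef : ((∑ _i : ι, (‖c - -c‖₊ / 2) ^ 2 : ℝ≥0) : ℝ) = Fintype.card ι * c ^ 2 := by
    simp only [Finset.sum_const, Finset.card_univ, nsmul_eq_mul, NNReal.coe_mul,
      NNReal.coe_natCast, NNReal.coe_pow, NNReal.coe_div, coe_nnnorm, Real.norm_eq_abs,
      NNReal.coe_ofNat, sub_neg_eq_add, ← two_mul, abs_mul, Nat.abs_ofNat, abs_of_pos hc,
      mul_div_cancel_left₀ c two_ne_zero]
  have hexp : -(c * ℓ * √(Fintype.card ι)) ^ 2 / (2 * (Fintype.card ι * c ^ 2))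
      = -(ℓ ^ 2 / 2) := by
    rw [mul_pow, Real.sq_sqrt hι.le]
    field_simp
  have upper := HasSubgaussianMGF.measure_sum_ge_le_of_iIndepFun hind (s := Finset.univ)
    (fun i _ => subgaussian i) hx
  have lower := HasSubgaussianMGF.measure_sum_ge_le_of_iIndepFun
    (hind.comp (fun _ x => -x) (by fun_prop)) (s := Finset.univ)
    (fun i _ => (subgaussian i).neg) hx
  simp only [Function.comp_apply, Finset.sum_neg_distrib] at lower
  rw [hcoef, hexp] at upper lower
  exact (measureReal_lt_abs_le_add _ _).trans (by linarith)

/-! ### Johnson–Lindenstrauss bounds for Gaussian matrices -/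

section Independence

variable {Ω : Type*} [MeasurableSpace Ω] {μ : Measure Ω}

lemma hasLaw_sum_mul_gaussianReal {ι : Type*} [Fintype ι] {Y : ι → Ω → ℝ} {v : ℝ≥0}
    (hind : iIndepFun Y μ) (hY : ∀ i, HasLaw (Y i) (gaussianReal 0 v) μ) (u : ι → ℝ) :
    HasLaw (fun ω => ∑ i, Y i ω * u i)
      (gaussianReal 0 (v * Real.toNNReal (u ⬝ᵥ u))) μ := by
  have := hind.isProbabilityMeasure
  have hYu (i : ι) :
      HasLaw (fun ω => Y i ω * u i) (gaussianReal 0 (.mk (u i ^ 2) (sq_nonneg _) * v)) μ := by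
    simpa using gaussianReal_mul_const (hY i) (u i)
  have hind_mul : iIndepFun (fun i ω => Y i ω * u i) μ :=
    hind.comp (fun i x => x * u i) (by fun_prop)
  have hsum := hind_mul.hasGaussianLaw_fun_sum fun i => (hYu i).hasGaussianLaw
  refine ⟨hsum.aemeasurable, ?_⟩
  rw [hsum.map_eq_gaussianReal]
  congr 1
  · rw [integral_finsetSum _ fun i _ => (hYu i).hasGaussianLaw.integrable]
    simp [(hYu _).integral_eq]
  · have hvar : variance (fun ω => ∑ i, Y i ω * u i) μ = v * (u ⬝ᵥ u) := by
      rw [← Finset.sum_fn, IndepFun.variance_sum (fun i _ => (hYu i).hasGaussianLaw.memLp_two)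
        fun i _ j _ hij => hind_mul.indepFun hij]
      simp only [(hYu _).variance_eq, variance_id_gaussianReal, NNReal.coe_mul, NNReal.coe_mk,
        dotProduct, Finset.mul_sum]
      exact Finset.sum_congr rfl fun i _ => by ring
    rw [hvar, Real.toNNReal_mul NNReal.zero_le_coe, Real.toNNReal_coe]

lemma iIndepFun_curry {κ L E : Type*} [Finite κ] [Finite L] [MeasurableSpace E]
    {F : κ × L → Ω → E} (hind : iIndepFun F μ) (hm : ∀ q, AEMeasurable (F q) μ) :
    iIndepFun (fun k ω l => F (k, l) ω) μ := by
  have := Fintype.ofFinite κ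
  have := Fintype.ofFinite L
  have := hind.isProbabilityMeasure
  have (q : κ × L) : IsProbabilityMeasure (μ.map (F q)) := Measure.isProbabilityMeasure_map (hm q)
  have row_law (k : κ) : HasLaw (fun ω l => F (k, l) ω)
      (Measure.pi fun l => μ.map (F (k, l))) μ :=
    (hind.precomp (Prod.mk_right_injective k)).hasLaw_pi fun l => ⟨hm (k, l), rfl⟩
  have curry_law : HasLaw (MeasurableEquiv.curry κ L E)
      (Measure.pi fun k => Measure.pi fun l => μ.map (F (k, l)))
      (Measure.pi fun q => μ.map (F q)) := by
    refine ⟨(MeasurableEquiv.measurable _).aemeasurable, ?_⟩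
    simpa only [Measure.infinitePi_eq_pi] using
      Measure.infinitePi_map_curry (ι := κ) (κ := L) (X := E) fun k l => μ.map (F (k, l))
  rw [iIndepFun_iff_hasLaw_pi_pi row_law]
  exact curry_law.comp (hind.hasLaw_pi fun q => ⟨hm q, rfl⟩)

lemma hasLaw_pi_pi_of_iIndepFun {κ L E : Type*} [Fintype κ] [Fintype L] [MeasurableSpace E]
    {F : κ × L → Ω → E} {ν : Measure E} [IsProbabilityMeasure ν] (hind : iIndepFun F μ)
    (hF : ∀ q, HasLaw (F q) ν μ) :
    HasLaw (fun ω k l => F (k, l) ω) (Measure.pi fun _ : κ => Measure.pi fun _ : L => ν) μ :=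
  (iIndepFun_curry hind fun q => (hF q).aemeasurable).hasLaw_pi fun k =>
    (hind.precomp (Prod.mk_right_injective k)).hasLaw_pi fun l => hF (k, l)

lemma indepFun_of_disjoint_range {ι A B E : Type*} [Finite A] [Finite B]
    [MeasurableSpace E] {F : ι → Ω → E} (hF : iIndepFun F μ) (hm : ∀ i, AEMeasurable (F i) μ)
    {f : A → ι} {g : B → ι} (hfg : ∀ a b, f a ≠ g b) :
    IndepFun (fun ω a => F (f a) ω) (fun ω b => F (g b) ω) μ := by
  classical
  have := Fintype.ofFinite A
  have := Fintype.ofFinite B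
  have hd : Disjoint (Finset.univ.image f) (Finset.univ.image g) := by
    simpa [Finset.disjoint_left] using fun a b => (hfg a b).symm
  exact (hF.indepFun_finset₀ _ _ hd hm).comp
    (φ := fun x a => x ⟨f a, Finset.mem_image_of_mem f (Finset.mem_univ a)⟩)
    (ψ := fun x b => x ⟨g b, Finset.mem_image_of_mem g (Finset.mem_univ b)⟩)
    (by fun_prop) (by fun_prop)

lemma measureReal_prodMk_mem_le_of_indepFun {α β : Type*} [MeasurableSpace α] [MeasurableSpace β]
    [IsProbabilityMeasure μ] {Z : Ω → α} {R : Ω → β} {ν : Measure β} [IsProbabilityMeasure ν]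
    (hind : IndepFun Z R μ) (hZ : AEMeasurable Z μ) (hR : HasLaw R ν μ)
    {S : Set (α × β)} (hS : MeasurableSet S) {ε : ℝ}
    (hε : ∀ z, ν.real (Prod.mk z ⁻¹' S) ≤ ε) :
    μ.real {ω | (Z ω, R ω) ∈ S} ≤ ε := by
  have := Measure.isProbabilityMeasure_map hZ
  have hjoint := hind.hasLaw_prod ⟨hZ, rfl⟩ hR
  obtain ⟨z₀⟩ : Nonempty α := (nonempty_of_isProbabilityMeasure (μ.map Z))
  have hε₀ : 0 ≤ ε := measureReal_nonneg.trans (hε z₀)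
  refine ENNReal.toReal_le_of_le_ofReal hε₀ ?_
  calc μ {ω | (Z ω, R ω) ∈ S} ≤ (μ.map fun ω => (Z ω, R ω)) S :=
        Measure.le_map_apply hjoint.aemeasurable S
    _ = ∫⁻ z, ν (Prod.mk z ⁻¹' S) ∂(μ.map Z) := by rw [hjoint.map_eq, Measure.prod_apply hS]
    _ ≤ ∫⁻ _, ENNReal.ofReal ε ∂(μ.map Z) := by
        refine lintegral_mono fun z => ?_
        rw [← ofReal_measureReal]
        exact ENNReal.ofReal_le_ofReal (hε z)
    _ = ENNReal.ofReal ε := by simp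

end Independence

section JohnsonLindenstrauss

lemma dotProduct_self_pos {L : Type*} [Fintype L] {u : L → ℝ} (hu : u ≠ 0) : 0 < u ⬝ᵥ u := by
  simpa only [star_trivial] using Matrix.dotProduct_self_star_pos_iff.2 hu

/-- The law of a random `κ × L` matrix with independent `N(0, 1/|κ|)` entries, so that
`‖R u‖² = ‖u‖²` in expectation. Matrices are encoded as functions `κ → L → ℝ` because `Matrix`
carries no measurable space. -/
noncomputable def gaussianSketch (κ L : Type*) [Fintype κ] [Fintype L] : Measure (κ → L → ℝ) :=
  Measure.pi fun _ => Measure.pi fun _ => gaussianReal 0 (1 / (Fintype.card κ : ℝ≥0))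

variable {κ L : Type*} [Fintype κ] [Fintype L]

instance : IsProbabilityMeasure (gaussianSketch κ L) := by
  unfold gaussianSketch; infer_instance

lemma iIndepFun_gaussianSketch_mulVec (u : L → ℝ) :
    iIndepFun (fun k R => (Matrix.of R *ᵥ u) k) (gaussianSketch κ L) :=
  iIndepFun_pi (X := fun _ x => x ⬝ᵥ u) fun _ =>
    (Finset.measurable_fun_sum _ fun l _ => (measurable_pi_apply l).mul_const _).aemeasurable

lemma hasLaw_gaussianSketch_mulVec (u : L → ℝ) (k : κ) :
    HasLaw (fun R => (Matrix.of R *ᵥ u) k)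
      (gaussianReal 0 (1 / (Fintype.card κ : ℝ≥0) * Real.toNNReal (u ⬝ᵥ u)))
      (gaussianSketch κ L) :=
  have entries_indep : iIndepFun (fun (l : L) (x : L → ℝ) => x l)
      (Measure.pi fun _ => gaussianReal 0 (1 / (Fintype.card κ : ℝ≥0))) :=
    iIndepFun_pi (X := fun _ x => x) fun _ => aemeasurable_id
  (hasLaw_sum_mul_gaussianReal entries_indep
    (fun l => (measurePreserving_eval (fun _ => gaussianReal 0 _) l).hasLaw) u).comp
    (measurePreserving_eval (fun _ => Measure.pi fun _ : L => _) k).hasLaw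

lemma four_mul_dotProduct_mulVec_eq {M : Matrix L L ℝ} (hM : M.IsSymm) (u v : L → ℝ) :
    4 * (u ⬝ᵥ M *ᵥ v) = (u + v) ⬝ᵥ M *ᵥ (u + v) - (u - v) ⬝ᵥ M *ᵥ (u - v) := by
  have hcomm : v ⬝ᵥ M *ᵥ u = u ⬝ᵥ M *ᵥ v := by
    rw [Matrix.dotProduct_mulVec, ← Matrix.mulVec_transpose, hM.eq, dotProduct_comm]
  simp only [Matrix.mulVec_add, Matrix.mulVec_sub, add_dotProduct, sub_dotProduct,
    dotProduct_add, dotProduct_sub, hcomm]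
  ring

variable [DecidableEq L]

lemma dotProduct_gram_sub_one_mulVec (R : Matrix κ L ℝ) (u v : L → ℝ) :
    u ⬝ᵥ (Rᵀ * R - 1) *ᵥ v = (R *ᵥ u) ⬝ᵥ (R *ᵥ v) - u ⬝ᵥ v := by
  rw [Matrix.sub_mulVec, Matrix.one_mulVec, dotProduct_sub, ← Matrix.mulVec_mulVec,
    Matrix.dotProduct_mulVec, Matrix.vecMul_transpose]

/-- The matrix `R` preserves the inner product of `u` and `v` up to the relative error `t`. -/
def PreservesInner (t : ℝ) (R : Matrix κ L ℝ) (u v : L → ℝ) : Prop :=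
  |u ⬝ᵥ (Rᵀ * R - 1) *ᵥ v| ≤ t * (√(u ⬝ᵥ u) * √(v ⬝ᵥ v))

lemma preservesInner_self_iff {t : ℝ} {R : Matrix κ L ℝ} {u : L → ℝ} :
    PreservesInner t R u u ↔ |(R *ᵥ u) ⬝ᵥ (R *ᵥ u) - u ⬝ᵥ u| ≤ t * (u ⬝ᵥ u) := by
  rw [PreservesInner, dotProduct_gram_sub_one_mulVec,
    Real.mul_self_sqrt (show 0 ≤ u ⬝ᵥ u from Finset.sum_nonneg fun _ _ => mul_self_nonneg _)]

/-- Polarization at the rescaled vectors `‖v‖ u ± ‖u‖ v`, whose squared norms sum to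
`4 ‖u‖² ‖v‖²`. -/
lemma preservesInner_of_add_of_sub {t : ℝ} {R : Matrix κ L ℝ} {u v : L → ℝ}
    (hadd : PreservesInner t R (√(v ⬝ᵥ v) • u + √(u ⬝ᵥ u) • v) (√(v ⬝ᵥ v) • u + √(u ⬝ᵥ u) • v))
    (hsub : PreservesInner t R (√(v ⬝ᵥ v) • u - √(u ⬝ᵥ u) • v)
      (√(v ⬝ᵥ v) • u - √(u ⬝ᵥ u) • v)) :
    PreservesInner t R u v := by
  rcases eq_or_ne u 0 with rfl | hu
  · simp [PreservesInner]
  rcases eq_or_ne v 0 with rfl | hv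
  · simp [PreservesInner]
  rw [preservesInner_self_iff, ← dotProduct_gram_sub_one_mulVec] at hadd hsub
  have ha := Real.sqrt_pos.2 (dotProduct_self_pos hu)
  have hc := Real.sqrt_pos.2 (dotProduct_self_pos hv)
  have hsqu := Real.sq_sqrt (dotProduct_self_pos hu).le
  have hsqv := Real.sq_sqrt (dotProduct_self_pos hv).le
  have symm : (Rᵀ * R - 1).IsSymm :=
    Matrix.IsSymm.sub (by rw [Matrix.IsSymm, Matrix.transpose_mul, Matrix.transpose_transpose])
      Matrix.isSymm_one
  rw [PreservesInner]
  set a := √(u ⬝ᵥ u)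
  set c := √(v ⬝ᵥ v)
  set M := Rᵀ * R - 1
  have polarization := four_mul_dotProduct_mulVec_eq symm (c • u) (a • v)
  have parallelogram : (c • u + a • v) ⬝ᵥ (c • u + a • v) + (c • u - a • v) ⬝ᵥ (c • u - a • v)
      = 4 * (a * c) ^ 2 := by
    simp only [add_dotProduct, sub_dotProduct, dotProduct_add, dotProduct_sub, smul_dotProduct,
      dotProduct_smul, smul_eq_mul, ← hsqu, ← hsqv]
    ring
  have scaled : 4 * ((a * c) * |u ⬝ᵥ M *ᵥ v|) ≤ t * (4 * (a * c) ^ 2) :=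
    calc 4 * ((a * c) * |u ⬝ᵥ M *ᵥ v|) = |4 * ((c • u) ⬝ᵥ M *ᵥ (a • v))| := by
          simp only [Matrix.mulVec_smul, smul_dotProduct, dotProduct_smul, smul_eq_mul, abs_mul,
            abs_of_pos ha, abs_of_pos hc, Nat.abs_ofNat]
          ring
      _ ≤ t * (4 * (a * c) ^ 2) := by
          rw [polarization, ← parallelogram, mul_add]
          exact (abs_sub _ _).trans (add_le_add hadd hsub)
  exact le_of_mul_le_mul_left (by linarith) (mul_pos ha hc)

lemma measureReal_not_preservesInner_self_le [Nonempty κ] (u : L → ℝ) {t : ℝ} (ht₀ : 0 ≤ t)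
    (ht₁ : t ≤ 1) :
    (gaussianSketch κ L).real {R | ¬PreservesInner t (Matrix.of R) u u}
      ≤ 2 * Real.exp (-(Fintype.card κ * t ^ 2 / 16)) := by
  simp only [preservesInner_self_iff, not_le]
  rcases eq_or_ne u 0 with rfl | hu
  · simp only [Matrix.mulVec_zero, zero_dotProduct, sub_self, mul_zero, abs_zero,
      lt_self_iff_false, Set.ofPred_false, measureReal_empty]
    positivity
  have huu := dotProduct_self_pos hu
  set v : ℝ≥0 := 1 / (Fintype.card κ : ℝ≥0) * Real.toNNReal (u ⬝ᵥ u)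
  have hv : v ≠ 0 := by simpa [v] using huu
  have hvu : Fintype.card κ * (v : ℝ) = u ⬝ᵥ u := by
    have : (Fintype.card κ : ℝ) ≠ 0 := by simp
    simp only [v, NNReal.coe_mul, NNReal.coe_div, NNReal.coe_one, NNReal.coe_natCast,
      Real.coe_toNNReal _ huu.le]
    field_simp
  have := measureReal_lt_abs_sum_sq_sub_le hv (iIndepFun_gaussianSketch_mulVec (κ := κ) u)
    (fun k => by simp only [Matrix.mulVec, dotProduct, Matrix.of_apply]; fun_prop)
    (hasLaw_gaussianSketch_mulVec u) ht₀ ht₁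
  simp only [Finset.sum_sub_distrib, Finset.sum_const, Finset.card_univ, nsmul_eq_mul, hvu,
    sq (Matrix.mulVec _ _ _)] at this
  exact this

lemma measureReal_not_preservesInner_le [Nonempty κ] (u v : L → ℝ) {t : ℝ} (ht₀ : 0 ≤ t)
    (ht₁ : t ≤ 1) :
    (gaussianSketch κ L).real {R | ¬PreservesInner t (Matrix.of R) u v}
      ≤ 4 * Real.exp (-(Fintype.card κ * t ^ 2 / 16)) := by
  set bad : (L → ℝ) → Set (κ → L → ℝ) := fun z => {R | ¬PreservesInner t (Matrix.of R) z z}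
  calc _ ≤ (gaussianSketch κ L).real (bad (√(v ⬝ᵥ v) • u + √(u ⬝ᵥ u) • v) ∪
          bad (√(v ⬝ᵥ v) • u - √(u ⬝ᵥ u) • v)) := by
        refine measureReal_mono fun R hR => ?_
        contrapose! hR
        rw [Set.mem_union, not_or] at hR
        exact not_not.2 (preservesInner_of_add_of_sub (not_not.1 hR.1) (not_not.1 hR.2))
    _ ≤ _ := measureReal_union_le _ _
    _ ≤ 2 * Real.exp (-(Fintype.card κ * t ^ 2 / 16)) +
          2 * Real.exp (-(Fintype.card κ * t ^ 2 / 16)) :=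
        add_le_add (measureReal_not_preservesInner_self_le _ ht₀ ht₁)
          (measureReal_not_preservesInner_self_le _ ht₀ ht₁)
    _ = _ := by ring

lemma measureReal_not_preservesInner_comp_le [Nonempty κ] {Ω α : Type*} [MeasurableSpace Ω]
    [MeasurableSpace α] {μ : Measure Ω} [IsProbabilityMeasure μ] {Z : Ω → α}
    {R : Ω → κ → L → ℝ} (hind : IndepFun Z R μ) (hZ : AEMeasurable Z μ)
    (hR : HasLaw R (gaussianSketch κ L) μ) {u v : α → L → ℝ} (hu : Measurable u)
    (hv : Measurable v) {t : ℝ} (ht₀ : 0 ≤ t) (ht₁ : t ≤ 1) :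
    μ.real {ω | ¬PreservesInner t (Matrix.of (R ω)) (u (Z ω)) (v (Z ω))}
      ≤ 4 * Real.exp (-(Fintype.card κ * t ^ 2 / 16)) := by
  refine measureReal_prodMk_mem_le_of_indepFun hind hZ hR
    (S := {q : α × (κ → L → ℝ) | ¬PreservesInner t (Matrix.of q.2) (u q.1) (v q.1)}) ?_
    fun z => measureReal_not_preservesInner_le (u z) (v z) ht₀ ht₁
  have (l : L) : Measurable fun q : α × (κ → L → ℝ) => u q.1 l :=
    (measurable_pi_apply l).comp (hu.comp measurable_fst)
  have (l : L) : Measurable fun q : α × (κ → L → ℝ) => v q.1 l :=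
    (measurable_pi_apply l).comp (hv.comp measurable_fst)
  simp only [PreservesInner, dotProduct_gram_sub_one_mulVec, not_le]
  simp only [Matrix.mulVec, dotProduct, Matrix.of_apply]
  exact measurableSet_lt (by fun_prop) (Measurable.abs (by fun_prop))

end JohnsonLindenstrauss

/-! ### The good event -/

section GoodEvent

/-- The vector `[ξ; -w θ₀; w]`: it is the residual of the augmented data at `θ₀`, and for `ξ = 0` it
is the part of the bias that does not depend on the estimate. -/
def augmentedNoise {n p : ℕ} (w : ℝ) (ξ : Fin n → ℝ) (θ₀ : Fin p → ℝ) :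
    Fin n ⊕ (Fin p ⊕ Unit) → ℝ :=
  Sum.elim ξ (Sum.elim (-(w • θ₀)) fun _ => w)

/-- The event on which the design is nearly orthogonal and nearly uncorrelated with the noise, and
the sketch `R` preserves the inner products entering the analysis of the private Lasso. The
parameter `ℓ` is the number of standard deviations allowed for each of these statistics. -/
structure IsGood {n p r : ℕ} (b bn w ℓ : ℝ) (X : Matrix (Fin n) (Fin p) ℝ) (ξ : Fin n → ℝ)
    (R : Matrix (Fin r) (Fin n ⊕ (Fin p ⊕ Unit)) ℝ) (θ₀ : Fin p → ℝ) : Prop where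
  abs_X_le : ∀ i j, |X i j| ≤ b
  abs_ξ_le : ∀ i, |ξ i| ≤ bn
  gram : ∀ j k, |(Xᵀ * X - (n : ℝ) • (1 : Matrix (Fin p) (Fin p) ℝ)) j k| ≤ (b ^ 2 + 1) * ℓ * √n
  cross : ∀ j, |(Xᵀ *ᵥ ξ) j| ≤ b * bn * ℓ * √n
  sketch_design : ∀ j k,
    PreservesInner (ℓ / √r) R ((augmentedDesign w X).col j) ((augmentedDesign w X).col k)
  sketch_noise : ∀ j,
    PreservesInner (ℓ / √r) R ((augmentedDesign w X).col j) (augmentedNoise w ξ θ₀)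
  sketch_shift : ∀ j,
    PreservesInner (ℓ / √r) R ((augmentedDesign w X).col j) (augmentedNoise w 0 θ₀)

lemma measureReal_exists_le {Ω A : Type*} [MeasurableSpace Ω] {μ : Measure Ω} [Fintype A]
    {P : A → Ω → Prop} {ε : ℝ} (hP : ∀ a, μ.real {ω | P a ω} ≤ ε) :
    μ.real {ω | ∃ a, P a ω} ≤ Fintype.card A * ε := by
  rw [Set.ofPred_exists]
  calc μ.real (⋃ a, {ω | P a ω}) ≤ ∑ a, μ.real {ω | P a ω} := measureReal_iUnion_fintype_le _
    _ ≤ ∑ _a : A, ε := Finset.sum_le_sum fun a _ => hP a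
    _ = Fintype.card A * ε := by rw [Finset.sum_const, Finset.card_univ, nsmul_eq_mul]

lemma ae_abs_le_truncatedGaussian (σ a : ℝ) : ∀ᵐ x ∂(truncatedGaussian σ a), |x| ≤ a :=
  (ae_cond_mem measurableSet_Icc).mono fun _ => abs_le.2

lemma integral_sq_eq_variance {D : Measure ℝ} (h₀ : ∫ x, x ∂D = 0) :
    ∫ x, x ^ 2 ∂D = variance id D :=
  (variance_of_integral_eq_zero aemeasurable_id h₀).symm

section Measurability

variable {n p : ℕ} (w : ℝ) (θ₀ : Fin p → ℝ)

lemma measurable_augmentedDesign_col (j : Fin p) :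
    Measurable fun z : (Fin n → Fin p → ℝ) × (Fin n → ℝ) =>
      (augmentedDesign w (Matrix.of z.1)).col j := by
  refine measurable_pi_lambda _ fun l => ?_
  rcases l with i | i | i <;>
    simp only [augmentedDesign, Matrix.col_apply, Matrix.fromRows_apply_inl,
      Matrix.fromRows_apply_inr, Matrix.of_apply] <;> fun_prop

lemma measurable_augmentedNoise :
    Measurable fun z : (Fin n → Fin p → ℝ) × (Fin n → ℝ) => augmentedNoise w z.2 θ₀ := by
  refine measurable_pi_lambda _ fun l => ?_
  rcases l with i | i | i <;> simp only [augmentedNoise, Sum.elim_inl, Sum.elim_inr] <;> fun_prop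

end Measurability

namespace IsModel

variable {Ω : Type*} [MeasurableSpace Ω] {μ : Measure Ω} {n p r : ℕ} {D : Measure ℝ} {σ bn : ℝ}
  {X : Ω → Matrix (Fin n) (Fin p) ℝ} {ξ : Ω → Fin n → ℝ}
  {R : Ω → Matrix (Fin r) (Fin n ⊕ (Fin p ⊕ Unit)) ℝ}

lemma aemeasurable_X (hM : IsModel μ D σ bn X ξ R) (i : Fin n) (j : Fin p) :
    AEMeasurable (fun ω => X ω i j) μ :=
  (hM.law_X i j).aemeasurable

lemma aemeasurable_ξ (hM : IsModel μ D σ bn X ξ R) (i : Fin n) : AEMeasurable (fun ω => ξ ω i) μ :=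
  (hM.law_ξ i).aemeasurable

lemma aemeasurable_entry (hM : IsModel μ D σ bn X ξ R)
    (q : (Fin n × Fin p) ⊕ (Fin n ⊕ (Fin r × (Fin n ⊕ (Fin p ⊕ Unit))))) :
    AEMeasurable (Sum.elim (fun (ij : Fin n × Fin p) ω => X ω ij.1 ij.2)
      (Sum.elim (fun (i : Fin n) ω => ξ ω i)
        (fun (kl : Fin r × (Fin n ⊕ (Fin p ⊕ Unit))) ω => R ω kl.1 kl.2)) q) μ := by
  rcases q with ij | i | kl
  exacts [hM.aemeasurable_X _ _, hM.aemeasurable_ξ _, (hM.law_R _ _).aemeasurable]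

lemma ae_abs_X_le (hM : IsModel μ D σ bn X ξ R) {b : ℝ} (hD : ∀ᵐ x ∂D, |x| ≤ b)
    (i : Fin n) (j : Fin p) : ∀ᵐ ω ∂μ, |X ω i j| ≤ b := by
  rw [← (hM.law_X i j).map_eq] at hD
  exact ae_of_ae_map (hM.aemeasurable_X i j) hD

lemma ae_abs_ξ_le (hM : IsModel μ D σ bn X ξ R) (i : Fin n) : ∀ᵐ ω ∂μ, |ξ ω i| ≤ bn := by
  have h := ae_abs_le_truncatedGaussian σ bn
  rw [← (hM.law_ξ i).map_eq] at h
  exact ae_of_ae_map (hM.aemeasurable_ξ i) h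

lemma ae_abs_le (hM : IsModel μ D σ bn X ξ R) {b : ℝ} (hD : ∀ᵐ x ∂D, |x| ≤ b) :
    ∀ᵐ ω ∂μ, (∀ i j, |X ω i j| ≤ b) ∧ ∀ i, |ξ ω i| ≤ bn :=
  (ae_all_iff.2 fun i => ae_all_iff.2 (hM.ae_abs_X_le hD i)).and (ae_all_iff.2 hM.ae_abs_ξ_le)

lemma integral_X (hM : IsModel μ D σ bn X ξ R) (h₀ : ∫ x, x ∂D = 0) (i : Fin n) (j : Fin p) :
    ∫ ω, X ω i j ∂μ = 0 :=
  (hM.law_X i j).integral_eq.trans h₀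

lemma indepFun_X (hM : IsModel μ D σ bn X ξ R) (i : Fin n) {j k : Fin p} (hjk : j ≠ k) :
    IndepFun (fun ω => X ω i j) (fun ω => X ω i k) μ :=
  hM.indep.indepFun (i := Sum.inl (i, j)) (j := Sum.inl (i, k)) (by simpa using hjk)

lemma indepFun_X_ξ (hM : IsModel μ D σ bn X ξ R) (i : Fin n) (j : Fin p) :
    IndepFun (fun ω => X ω i j) (fun ω => ξ ω i) μ :=
  hM.indep.indepFun (i := Sum.inl (i, j)) (j := Sum.inr (Sum.inl i)) (by simp)

lemma integral_X_mul_X (hM : IsModel μ D σ bn X ξ R) (h₀ : ∫ x, x ∂D = 0)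
    (h₁ : variance id D = 1) (i : Fin n) (j k : Fin p) :
    ∫ ω, X ω i j * X ω i k ∂μ = if j = k then 1 else 0 := by
  split_ifs with hjk
  · subst hjk
    rw [← h₁, ← integral_sq_eq_variance h₀]
    simpa only [Function.comp_def, ← sq] using
      (hM.law_X i j).integral_comp (f := fun x : ℝ => x ^ 2) (by fun_prop)
  · simpa only [Pi.mul_apply, hM.integral_X h₀, zero_mul] using
      (hM.indepFun_X i hjk).integral_mul_eq_mul_integral
        (hM.aemeasurable_X i j).aestronglyMeasurable
        (hM.aemeasurable_X i k).aestronglyMeasurable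

lemma integral_X_mul_ξ (hM : IsModel μ D σ bn X ξ R) (h₀ : ∫ x, x ∂D = 0) (i : Fin n)
    (j : Fin p) : ∫ ω, X ω i j * ξ ω i ∂μ = 0 := by
  simpa only [Pi.mul_apply, hM.integral_X h₀, zero_mul] using
    (hM.indepFun_X_ξ i j).integral_mul_eq_mul_integral (hM.aemeasurable_X i j).aestronglyMeasurable
      (hM.aemeasurable_ξ i).aestronglyMeasurable

lemma iIndepFun_rows_X (hM : IsModel μ D σ bn X ξ R) : iIndepFun (fun i ω j => X ω i j) μ :=
  iIndepFun_curry (F := fun (q : Fin n × Fin p) ω => X ω q.1 q.2)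
    (hM.indep.precomp (g := Sum.inl) Sum.inl_injective) fun q => hM.aemeasurable_X q.1 q.2

lemma iIndepFun_X_mul_ξ (hM : IsModel μ D σ bn X ξ R) (j : Fin p) :
    iIndepFun (fun i ω => X ω i j * ξ ω i) μ := by
  let entry : Fin n × Bool → (Fin n × Fin p) ⊕ (Fin n ⊕ (Fin r × (Fin n ⊕ (Fin p ⊕ Unit)))) :=
    fun q => if q.2 then Sum.inl (q.1, j) else Sum.inr (Sum.inl q.1)
  have entry_injective : Function.Injective entry := by
    rintro ⟨i, x⟩ ⟨i', x'⟩ h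
    rcases x <;> rcases x' <;> simp_all [entry]
  exact (iIndepFun_curry (hM.indep.precomp (g := entry) entry_injective) fun q =>
    hM.aemeasurable_entry (entry q)).comp
    (fun _ x => x true * x false) (by fun_prop)

lemma hasLaw_sketch (hM : IsModel μ D σ bn X ξ R) :
    HasLaw (fun ω k l => R ω k l) (gaussianSketch (Fin r) (Fin n ⊕ (Fin p ⊕ Unit))) μ := by
  rw [gaussianSketch, Fintype.card_fin]
  exact hasLaw_pi_pi_of_iIndepFun (F := fun kl ω => R ω kl.1 kl.2)
    (hM.indep.precomp (g := fun kl => Sum.inr (Sum.inr kl))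
      (Sum.inr_injective.comp Sum.inr_injective)) fun kl => hM.law_R kl.1 kl.2

lemma indepFun_data_sketch (hM : IsModel μ D σ bn X ξ R) :
    IndepFun (fun ω => ((fun i j => X ω i j, ξ ω) : (Fin n → Fin p → ℝ) × (Fin n → ℝ)))
      (fun ω k l => R ω k l) μ :=
  (indepFun_of_disjoint_range hM.indep hM.aemeasurable_entry
    (f := (Sum.map id Sum.inl : (Fin n × Fin p) ⊕ Fin n → _)) (g := fun kl => Sum.inr (Sum.inr kl))
    (by rintro (ij | i) kl <;> simp)).comp
    (φ := fun z => (fun i j => z (Sum.inl (i, j)), fun i => z (Sum.inr i)))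
    (ψ := fun z k l => z (k, l)) (by fun_prop) (by fun_prop)

lemma measureReal_not_preservesInner_le [IsProbabilityMeasure μ] (hM : IsModel μ D σ bn X ξ R)
    (hr : 0 < r) {ℓ : ℝ} (hℓ : 0 ≤ ℓ) (hℓr : ℓ ≤ √r)
    {u v : (Fin n → Fin p → ℝ) × (Fin n → ℝ) → Fin n ⊕ (Fin p ⊕ Unit) → ℝ} (hu : Measurable u)
    (hv : Measurable v) :
    μ.real {ω | ¬PreservesInner (ℓ / √r) (R ω) (u (X ω, ξ ω)) (v (X ω, ξ ω))}
      ≤ 4 * Real.exp (-(ℓ ^ 2 / 16)) := by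
  have : Nonempty (Fin r) := ⟨⟨0, hr⟩⟩
  have hr₀ : (0 : ℝ) < r := by exact_mod_cast hr
  have hexp : Fintype.card (Fin r) * (ℓ / √r) ^ 2 = ℓ ^ 2 := by
    rw [Fintype.card_fin, div_pow, Real.sq_sqrt hr₀.le, mul_div_cancel₀ _ hr₀.ne']
  rw [← hexp]
  refine measureReal_not_preservesInner_comp_le hM.indepFun_data_sketch ?_ hM.hasLaw_sketch hu hv
    (by positivity) (div_le_one_of_le₀ hℓr (Real.sqrt_nonneg _))
  exact (aemeasurable_pi_lambda _ fun i => aemeasurable_pi_lambda _ fun j =>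
    hM.aemeasurable_X i j).prodMk (aemeasurable_pi_lambda _ hM.aemeasurable_ξ)

lemma measureReal_lt_abs_gram_le [IsProbabilityMeasure μ] (hM : IsModel μ D σ bn X ξ R)
    (hn : 0 < n) {b ℓ : ℝ} (hb : 0 ≤ b) (hℓ : 0 ≤ ℓ) (hD : ∀ᵐ x ∂D, |x| ≤ b)
    (h₀ : ∫ x, x ∂D = 0) (h₁ : variance id D = 1) (j k : Fin p) :
    μ.real {ω | (b ^ 2 + 1) * ℓ * √n <
        |((X ω)ᵀ * X ω - (n : ℝ) • (1 : Matrix (Fin p) (Fin p) ℝ)) j k|}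
      ≤ 2 * Real.exp (-(ℓ ^ 2 / 2)) := by
  have : Nonempty (Fin n) := ⟨⟨0, hn⟩⟩
  have abs_X_mul_X_le (i : Fin n) : ∀ᵐ ω ∂μ, |X ω i j * X ω i k| ≤ b ^ 2 := by
    filter_upwards [hM.ae_abs_X_le hD i j, hM.ae_abs_X_le hD i k] with ω hj hk
    rw [abs_mul, sq]
    exact mul_le_mul hj hk (abs_nonneg _) hb
  have hm (i : Fin n) : AEMeasurable (fun ω => X ω i j * X ω i k) μ :=
    (hM.aemeasurable_X i j).mul (hM.aemeasurable_X i k)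
  have hoeffding := measureReal_lt_abs_sum_le
    (Y := fun i ω => X ω i j * X ω i k - if j = k then 1 else 0) (c := b ^ 2 + 1)
    (hM.iIndepFun_rows_X.comp (fun _ x => x j * x k - if j = k then 1 else 0) (by fun_prop))
    (fun i => (hm i).sub_const _) (by positivity) hℓ (fun i => ?_) fun i => ?_
  · simpa [Matrix.mul_apply, Matrix.one_apply] using hoeffding
  · filter_upwards [abs_X_mul_X_le i] with ω hω
    refine (abs_sub _ _).trans (add_le_add hω ?_)
    split_ifs <;> simp
  · rw [integral_sub (Integrable.of_bound (hm i).aestronglyMeasurable _ (abs_X_mul_X_le i))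
      (integrable_const _), hM.integral_X_mul_X h₀ h₁]
    simp

lemma measureReal_lt_abs_cross_le (hM : IsModel μ D σ bn X ξ R) (hn : 0 < n) {b ℓ : ℝ}
    (hb : 0 < b) (hbn : 0 < bn) (hℓ : 0 ≤ ℓ) (hD : ∀ᵐ x ∂D, |x| ≤ b) (h₀ : ∫ x, x ∂D = 0)
    (j : Fin p) :
    μ.real {ω | b * bn * ℓ * √n < |((X ω)ᵀ *ᵥ ξ ω) j|} ≤ 2 * Real.exp (-(ℓ ^ 2 / 2)) := by
  have : Nonempty (Fin n) := ⟨⟨0, hn⟩⟩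
  have hoeffding := measureReal_lt_abs_sum_le (hM.iIndepFun_X_mul_ξ j)
    (fun i => (hM.aemeasurable_X i j).mul (hM.aemeasurable_ξ i)) (mul_pos hb hbn) hℓ (fun i => ?_)
    (hM.integral_X_mul_ξ h₀ · j)
  · simpa [Matrix.mulVec, dotProduct] using hoeffding
  · filter_upwards [hM.ae_abs_X_le hD i j, hM.ae_abs_ξ_le i] with ω hj hi
    rw [abs_mul]
    exact mul_le_mul hj hi (abs_nonneg _) hb.le

theorem measureReal_not_isGood_le [IsProbabilityMeasure μ] (hM : IsModel μ D σ bn X ξ R)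
    (hn : 0 < n) (hr : 0 < r) {b ℓ : ℝ} (hb : 0 < b) (hbn : 0 < bn) (hℓ : 0 ≤ ℓ) (hℓr : ℓ ≤ √r)
    (hD : ∀ᵐ x ∂D, |x| ≤ b) (h₀ : ∫ x, x ∂D = 0) (h₁ : variance id D = 1) (w : ℝ)
    (θ₀ : Fin p → ℝ) :
    μ.real {ω | ¬IsGood b bn w ℓ (X ω) (ξ ω) (R ω) θ₀} ≤
      (2 * p ^ 2 + 3 * p) * (4 * Real.exp (-(ℓ ^ 2 / 16))) := by
  set ε : ℝ := 4 * Real.exp (-(ℓ ^ 2 / 16))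
  have exp_le_ε : 2 * Real.exp (-(ℓ ^ 2 / 2)) ≤ ε := by
    refine mul_le_mul (by norm_num) (Real.exp_le_exp.2 ?_) (Real.exp_pos _).le (by norm_num)
    linarith [sq_nonneg ℓ]
  have hdesign (j : Fin p) := measurable_augmentedDesign_col (n := n) w j
  have gram_le := measureReal_exists_le fun q : Fin p × Fin p =>
    (hM.measureReal_lt_abs_gram_le hn hb.le hℓ hD h₀ h₁ q.1 q.2).trans exp_le_ε
  have cross_le := measureReal_exists_le fun j : Fin p =>
    (hM.measureReal_lt_abs_cross_le hn hb hbn hℓ hD h₀ j).trans exp_le_ε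
  have design_le := measureReal_exists_le fun q : Fin p × Fin p =>
    hM.measureReal_not_preservesInner_le hr hℓ hℓr (hdesign q.1) (hdesign q.2)
  have noise_le := measureReal_exists_le fun j : Fin p =>
    hM.measureReal_not_preservesInner_le hr hℓ hℓr (hdesign j) (measurable_augmentedNoise w θ₀)
  have shift_le := measureReal_exists_le fun j : Fin p =>
    hM.measureReal_not_preservesInner_le hr hℓ hℓr (hdesign j)
      (measurable_const (a := augmentedNoise w 0 θ₀))
  have bounded : μ.real {ω | ¬((∀ i j, |X ω i j| ≤ b) ∧ ∀ i, |ξ ω i| ≤ bn)} = 0 := by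
    rw [measureReal_def, ae_iff.1 (hM.ae_abs_le hD), ENNReal.toReal_zero]
  refine (measureReal_mono (s₂ := _ ∪ (_ ∪ (_ ∪ (_ ∪ (_ ∪ _))))) fun ω hω => ?_).trans <|
    (measureReal_union_le _ _).trans <| (add_le_add bounded.le <|
    (measureReal_union_le _ _).trans <| add_le_add gram_le <|
    (measureReal_union_le _ _).trans <| add_le_add cross_le <|
    (measureReal_union_le _ _).trans <| add_le_add design_le <|
    (measureReal_union_le _ _).trans <| add_le_add noise_le shift_le).trans ?_
  · by_contra hnot
    simp only [Set.mem_union, Set.mem_ofPred, not_or, not_exists, not_not, not_lt] at hnot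
    obtain ⟨⟨hX, hξ⟩, gram, cross, design, noise, shift⟩ := hnot
    exact hω ⟨hX, hξ, fun j k => gram (j, k), cross, fun j k => design (j, k), noise, shift⟩
  · simp only [Fintype.card_prod, Fintype.card_fin, Nat.cast_mul]
    exact le_of_eq (by ring)

end IsModel

end GoodEvent

/-! ### The Lasso without sparsity -/

section Lasso

variable {ι : Type*} [Fintype ι]

lemma abs_dotProduct_le_mul_sum_abs {g : ι → ℝ} {N : ℝ} (hg : ∀ j, |g j| ≤ N) (h : ι → ℝ) :
    |g ⬝ᵥ h| ≤ N * ∑ j, |h j| := by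
  rw [Finset.mul_sum]
  refine (Finset.abs_sum_le_sum_abs _ _).trans (Finset.sum_le_sum fun j _ => ?_)
  rw [abs_mul]
  exact mul_le_mul_of_nonneg_right (hg j) (abs_nonneg _)

lemma abs_dotProduct_mulVec_self_le {M : Matrix ι ι ℝ} {e : ℝ} (hM : ∀ j k, |M j k| ≤ e)
    (h : ι → ℝ) : |h ⬝ᵥ M *ᵥ h| ≤ e * (∑ j, |h j|) ^ 2 := by
  rw [dotProduct_comm, sq, ← mul_assoc]
  exact abs_dotProduct_le_mul_sum_abs (fun j => abs_dotProduct_le_mul_sum_abs (hM j) h) h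

lemma sq_sum_abs_le_card_mul (h : ι → ℝ) : (∑ j, |h j|) ^ 2 ≤ Fintype.card ι * (h ⬝ᵥ h) := by
  simpa only [Finset.card_univ, sq_abs, dotProduct, ← sq] using
    sq_sum_le_card_mul_sum_sq (s := Finset.univ) (f := fun j => |h j|)

lemma half_dotProduct_self_le_of_abs_sub_smul_one_le [DecidableEq ι] {G : Matrix ι ι ℝ} {c e : ℝ}
    (hc : 1 ≤ c) (he : Fintype.card ι * e ≤ 1 / 2) (he₀ : 0 ≤ e)
    (hG : ∀ j k, |(G - c • (1 : Matrix ι ι ℝ)) j k| ≤ e) (h : ι → ℝ) :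
    1 / 2 * (h ⬝ᵥ h) ≤ h ⬝ᵥ G *ᵥ h := by
  have hh : 0 ≤ h ⬝ᵥ h := Finset.sum_nonneg fun _ _ => mul_self_nonneg _
  have defect := (abs_le.1 (abs_dotProduct_mulVec_self_le hG h)).1
  simp only [Matrix.sub_mulVec, Matrix.smul_mulVec, Matrix.one_mulVec, dotProduct_sub,
    dotProduct_smul, smul_eq_mul] at defect
  have defect_le : e * (∑ j, |h j|) ^ 2 ≤ 1 / 2 * (h ⬝ᵥ h) :=
    calc e * (∑ j, |h j|) ^ 2 ≤ e * (Fintype.card ι * (h ⬝ᵥ h)) := by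
          gcongr; exact sq_sum_abs_le_card_mul h
      _ = Fintype.card ι * e * (h ⬝ᵥ h) := by ring
      _ ≤ 1 / 2 * (h ⬝ᵥ h) := by gcongr
  linarith [mul_le_mul_of_nonneg_right hc hh]

lemma sum_abs_le_of_basic_inequality {h g : ι → ℝ} {G : Matrix ι ι ℝ} {N lam : ℝ}
    (hN : 0 ≤ N + lam) (hg : ∀ j, |g j| ≤ N) (hG : 1 / 2 * (h ⬝ᵥ h) ≤ h ⬝ᵥ G *ᵥ h)
    (basic : 1 / 2 * (h ⬝ᵥ G *ᵥ h) + g ⬝ᵥ h ≤ lam * ∑ j, |h j|) :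
    ∑ j, |h j| ≤ 4 * Fintype.card ι * (N + lam) := by
  have score := (abs_le.1 (abs_dotProduct_le_mul_sum_abs hg h)).1
  have sq_le : (∑ j, |h j|) * ∑ j, |h j| ≤ 4 * Fintype.card ι * (N + lam) * ∑ j, |h j| :=
    calc (∑ j, |h j|) * ∑ j, |h j| ≤ Fintype.card ι * (h ⬝ᵥ h) := by
          rw [← sq]; exact sq_sum_abs_le_card_mul h
      _ ≤ Fintype.card ι * (4 * ((N + lam) * ∑ j, |h j|)) := by gcongr; linarith
      _ = 4 * Fintype.card ι * (N + lam) * ∑ j, |h j| := by ring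
  rcases (Finset.sum_nonneg fun j _ => abs_nonneg (h j)).eq_or_lt with h₀ | h₀
  · rw [← h₀]; positivity
  · exact le_of_mul_le_mul_right sq_le h₀

variable {p r : ℕ}

lemma lassoObjective_eq (n : ℕ) (lam : ℝ) (A : Matrix (Fin r) (Fin p) ℝ) (v : Fin r → ℝ)
    (θ₀ θ : Fin p → ℝ) :
    lassoObjective n lam A v θ =
      1 / 2 * ((θ₀ - θ) ⬝ᵥ ((1 / (n : ℝ)) • (Aᵀ * A)) *ᵥ (θ₀ - θ)) +
        ((1 / (n : ℝ)) • Aᵀ *ᵥ (v - A *ᵥ θ₀)) ⬝ᵥ (θ₀ - θ) +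
        1 / (2 * n) * ((v - A *ᵥ θ₀) ⬝ᵥ (v - A *ᵥ θ₀)) + lam * ∑ j, |θ j| := by
  set h := θ₀ - θ
  set ε := v - A *ᵥ θ₀
  have residual : A *ᵥ θ - v = -(A *ᵥ h + ε) := by
    simp only [h, ε, Matrix.mulVec_sub]; abel
  have fit : ∑ k, ((A *ᵥ θ) k - v k) ^ 2 = (A *ᵥ h + ε) ⬝ᵥ (A *ᵥ h + ε) := by
    simp only [← Pi.sub_apply, residual, Pi.neg_apply, dotProduct, sq, neg_mul_neg]
  have gram : h ⬝ᵥ (Aᵀ * A) *ᵥ h = (A *ᵥ h) ⬝ᵥ (A *ᵥ h) := by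
    rw [← Matrix.mulVec_mulVec, Matrix.dotProduct_mulVec, Matrix.vecMul_transpose]
  have score : (Aᵀ *ᵥ ε) ⬝ᵥ h = ε ⬝ᵥ (A *ᵥ h) := by
    rw [Matrix.mulVec_transpose, Matrix.dotProduct_mulVec]
  rw [lassoObjective, fit, Matrix.smul_mulVec, dotProduct_smul, gram, smul_dotProduct, score]
  simp only [add_dotProduct, dotProduct_add, smul_eq_mul, dotProduct_comm (A *ᵥ h) ε, one_div,
    mul_inv]
  ring

lemma basic_inequality_of_lassoObjective_le {n : ℕ} {lam : ℝ} (hlam : 0 ≤ lam)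
    {A : Matrix (Fin r) (Fin p) ℝ} {v : Fin r → ℝ} {θ₀ θ : Fin p → ℝ}
    (hθ : lassoObjective n lam A v θ ≤ lassoObjective n lam A v θ₀) :
    1 / 2 * ((θ₀ - θ) ⬝ᵥ ((1 / (n : ℝ)) • (Aᵀ * A)) *ᵥ (θ₀ - θ)) +
      ((1 / (n : ℝ)) • Aᵀ *ᵥ (v - A *ᵥ θ₀)) ⬝ᵥ (θ₀ - θ) ≤ lam * ∑ j, |(θ₀ - θ) j| := by
  rw [lassoObjective_eq n lam A v θ₀ θ, lassoObjective_eq n lam A v θ₀ θ₀, sub_self,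
    zero_dotProduct, dotProduct_zero] at hθ
  have triangle : ∑ j, |θ₀ j| - ∑ j, |θ j| ≤ ∑ j, |(θ₀ - θ) j| := by
    rw [← Finset.sum_sub_distrib]
    exact Finset.sum_le_sum fun j _ => abs_sub_abs_le_abs_sub _ _
  linarith [mul_le_mul_of_nonneg_left triangle hlam]

end Lasso

/-! ### The bias on the good event -/

section Bias

variable {n p r : ℕ} (w : ℝ) (X : Matrix (Fin n) (Fin p) ℝ) (ξ : Fin n → ℝ) (θ₀ : Fin p → ℝ)
  (R : Matrix (Fin r) (Fin n ⊕ (Fin p ⊕ Unit)) ℝ)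

lemma privateX_eq (y : Fin n → ℝ) : privateX w X y R = R * augmentedDesign w X := by
  ext k j
  simp only [privateX, privateData, Matrix.toCols₁_apply, Matrix.mul_apply]
  refine Finset.sum_congr rfl fun l _ => ?_
  rcases l with i | i | i <;> simp [augmentedDesign, Matrix.one_apply]

lemma privateY_eq : privateY w X (X *ᵥ θ₀ + ξ) R =
    R *ᵥ (augmentedDesign w X *ᵥ θ₀ + augmentedNoise w ξ θ₀) := by
  ext k
  simp only [privateY, privateData, Matrix.mul_apply, Matrix.mulVec, dotProduct]
  refine Finset.sum_congr rfl fun l _ => congrArg (R k l * ·) ?_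
  rcases l with i | i | i <;>
    simp [augmentedDesign, augmentedNoise, Matrix.mulVec, dotProduct, Matrix.one_apply]

lemma privateY_sub_privateX_mulVec :
    privateY w X (X *ᵥ θ₀ + ξ) R - privateX w X (X *ᵥ θ₀ + ξ) R *ᵥ θ₀ =
      R *ᵥ augmentedNoise w ξ θ₀ := by
  rw [privateX_eq, privateY_eq, Matrix.mulVec_add, Matrix.mulVec_mulVec, add_sub_cancel_left]

lemma transpose_augmentedDesign_mul_self :
    (augmentedDesign w X)ᵀ * augmentedDesign w X = Xᵀ * X + w ^ 2 • 1 := by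
  simp [augmentedDesign, Matrix.transpose_fromRows, Matrix.fromCols_mul_fromRows, sq, smul_smul]

lemma transpose_augmentedDesign_mulVec_augmentedNoise :
    (augmentedDesign w X)ᵀ *ᵥ augmentedNoise w ξ θ₀ = Xᵀ *ᵥ ξ - w ^ 2 • θ₀ := by
  simp [augmentedDesign, augmentedNoise, Matrix.transpose_fromRows, Matrix.fromCols_mulVec,
    Matrix.smul_mulVec, Matrix.mulVec_neg, Matrix.mulVec_smul, sq, smul_smul, sub_eq_add_neg]

lemma augmentedNoise_dotProduct_self :
    augmentedNoise w ξ θ₀ ⬝ᵥ augmentedNoise w ξ θ₀ = ξ ⬝ᵥ ξ + w ^ 2 * (θ₀ ⬝ᵥ θ₀ + 1) := by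
  simp only [augmentedNoise, sumElim_dotProduct_sumElim, neg_dotProduct_neg, smul_dotProduct,
    dotProduct_smul, smul_eq_mul, dotProduct_pUnit]
  ring

/-- The deviation of the normalized Gram matrix of the private design from its mean `φ_w I`. -/
noncomputable def gramDefect : Matrix (Fin p) (Fin p) ℝ :=
  (1 / (n : ℝ)) • ((R * augmentedDesign w X)ᵀ * (R * augmentedDesign w X)) - phiW n w • 1

lemma gramDefect_eq : gramDefect w X R = ((1 / (n : ℝ)) • (Xᵀ * X) - 1) +
    (1 / (n : ℝ)) • ((augmentedDesign w X)ᵀ * (Rᵀ * R - 1) * augmentedDesign w X) := by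
  rw [gramDefect, phiW, Matrix.mul_sub, Matrix.sub_mul, Matrix.mul_one,
    transpose_augmentedDesign_mul_self, Matrix.transpose_mul]
  simp only [Matrix.mul_assoc]
  module

/-- The vector `[X (θ₀ - θ); -wθ; w]` in the definition of the bias is `A (θ₀ - θ) + [0; -wθ₀; w]`,
with `A` the augmented design, and `AᵀA = XᵀX + w² I`. -/
lemma bias_eq (θ : Fin p → ℝ) : bias w X R θ₀ θ = gramDefect w X R *ᵥ (θ₀ - θ) +
    (1 / (n : ℝ)) • (augmentedDesign w X)ᵀ *ᵥ (Rᵀ * R - 1) *ᵥ augmentedNoise w 0 θ₀ := by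
  have split : Sum.elim (X *ᵥ (θ₀ - θ)) (Sum.elim (-(w • θ)) fun _ => w) =
      augmentedDesign w X *ᵥ (θ₀ - θ) + augmentedNoise w 0 θ₀ := by
    ext l
    rcases l with i | i | i <;>
      simp [augmentedDesign, augmentedNoise, Matrix.fromRows_mulVec, Matrix.smul_mulVec]
    ring
  rw [bias, split, gramDefect_eq, Matrix.add_mulVec, Matrix.smul_mulVec, ← Matrix.mulVec_mulVec,
    ← Matrix.mulVec_mulVec, Matrix.mulVec_add, Matrix.mulVec_add, smul_add, add_assoc]

variable {w X ξ θ₀ R}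

lemma PreservesInner.abs_le {κ L : Type*} [Fintype κ] [Fintype L] [DecidableEq L] {t a c : ℝ}
    {R : Matrix κ L ℝ} {u v : L → ℝ} (h : PreservesInner t R u v) (ht : 0 ≤ t)
    (hu : √(u ⬝ᵥ u) ≤ a) (hv : √(v ⬝ᵥ v) ≤ c) : |u ⬝ᵥ (Rᵀ * R - 1) *ᵥ v| ≤ t * (a * c) :=
  h.trans (mul_le_mul_of_nonneg_left
    (mul_le_mul hu hv (Real.sqrt_nonneg _) ((Real.sqrt_nonneg _).trans hu)) ht)

lemma dotProduct_self_le_card_mul_sq {ι : Type*} [Fintype ι] {f : ι → ℝ} {c : ℝ}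
    (hf : ∀ i, |f i| ≤ c) : f ⬝ᵥ f ≤ Fintype.card ι * c ^ 2 := by
  rw [← nsmul_eq_mul]
  exact Finset.sum_le_card_nsmul _ _ _ fun i _ => by
    rw [← sq]; exact sq_le_sq.2 ((hf i).trans (le_abs_self c))

namespace IsGood

variable {b bn ℓ : ℝ}

lemma sqrt_col_le (hgood : IsGood b bn w ℓ X ξ R θ₀) (hw : w ^ 2 ≤ n) (j : Fin p) :
    √((augmentedDesign w X).col j ⬝ᵥ (augmentedDesign w X).col j) ≤ √(b ^ 2 + 1) * √n := by
  have col_sq : (augmentedDesign w X).col j ⬝ᵥ (augmentedDesign w X).col j =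
      X.col j ⬝ᵥ X.col j + w ^ 2 :=
    (congrFun₂ (transpose_augmentedDesign_mul_self w X) j j).trans <| by
      rw [Matrix.add_apply, Matrix.smul_apply, Matrix.one_apply_eq, smul_eq_mul, mul_one]
      rfl
  have X_col_le : X.col j ⬝ᵥ X.col j ≤ n * b ^ 2 := by
    simpa using dotProduct_self_le_card_mul_sq (f := X.col j) (hgood.abs_X_le · j)
  rw [← Real.sqrt_mul (by positivity), col_sq]
  exact Real.sqrt_le_sqrt (by linarith)

lemma sqrt_noise_le (hgood : IsGood b bn w ℓ X ξ R θ₀) (hw : w ^ 2 ≤ n) (hθ₀ : θ₀ ⬝ᵥ θ₀ = 1) :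
    √(augmentedNoise w ξ θ₀ ⬝ᵥ augmentedNoise w ξ θ₀) ≤ √(bn ^ 2 + 2) * √n := by
  have ξ_le : ξ ⬝ᵥ ξ ≤ n * bn ^ 2 := by
    simpa using dotProduct_self_le_card_mul_sq hgood.abs_ξ_le
  rw [← Real.sqrt_mul (by positivity), augmentedNoise_dotProduct_self, hθ₀]
  exact Real.sqrt_le_sqrt (by linarith)

lemma abs_sketch_le (hgood : IsGood b bn w ℓ X ξ R θ₀) (hn : 0 < n) (hw : w ^ 2 ≤ n) (hℓ : 0 ≤ ℓ)
    {v : Fin n ⊕ (Fin p ⊕ Unit) → ℝ} {c : ℝ} (hv : √(v ⬝ᵥ v) ≤ c * √n) {j : Fin p}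
    (h : PreservesInner (ℓ / √r) R ((augmentedDesign w X).col j) v) :
    |((1 / (n : ℝ)) • (augmentedDesign w X)ᵀ *ᵥ (Rᵀ * R - 1) *ᵥ v) j| ≤
      ℓ / √r * (√(b ^ 2 + 1) * c) := by
  have hn' : (n : ℝ) ≠ 0 := by positivity
  rw [Pi.smul_apply, smul_eq_mul, abs_mul, abs_of_nonneg (by positivity)]
  calc 1 / (n : ℝ) * |(augmentedDesign w X).col j ⬝ᵥ (Rᵀ * R - 1) *ᵥ v|
      ≤ 1 / n * (ℓ / √r * (√(b ^ 2 + 1) * √n * (c * √n))) := by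
        gcongr
        exact h.abs_le (by positivity) (hgood.sqrt_col_le hw j) hv
    _ = 1 / n * (√n * √n) * (ℓ / √r * (√(b ^ 2 + 1) * c)) := by ring
    _ = ℓ / √r * (√(b ^ 2 + 1) * c) := by
        rw [Real.mul_self_sqrt n.cast_nonneg, one_div_mul_cancel hn', one_mul]

lemma abs_gramDefect_le (hgood : IsGood b bn w ℓ X ξ R θ₀) (hn : 0 < n) (hw : w ^ 2 ≤ n)
    (hℓ : 0 ≤ ℓ) (j k : Fin p) :
    |gramDefect w X R j k| ≤ (b ^ 2 + 1) * (ℓ / √n) + (b ^ 2 + 1) * (ℓ / √r) := by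
  have hn' : (n : ℝ) ≠ 0 := by positivity
  have design : |((1 / (n : ℝ)) • (Xᵀ * X) - (1 : Matrix (Fin p) (Fin p) ℝ)) j k| ≤
      (b ^ 2 + 1) * (ℓ / √n) := by
    have factor : (1 / (n : ℝ)) • (Xᵀ * X) - 1 = (1 / (n : ℝ)) • (Xᵀ * X - (n : ℝ) • 1) := by
      rw [smul_sub, smul_smul, one_div_mul_cancel hn', one_smul]
    rw [factor, Matrix.smul_apply, smul_eq_mul, abs_mul, abs_of_nonneg (by positivity)]
    calc 1 / (n : ℝ) * |(Xᵀ * X - (n : ℝ) • (1 : Matrix (Fin p) (Fin p) ℝ)) j k|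
        ≤ 1 / n * ((b ^ 2 + 1) * ℓ * √n) := by gcongr; exact hgood.gram j k
      _ = (b ^ 2 + 1) * (ℓ / √n) := by
          rw [div_eq_mul_one_div ℓ, ← Real.sqrt_div_self']; ring
  have sketch := hgood.abs_sketch_le hn hw hℓ (hgood.sqrt_col_le hw k) (hgood.sketch_design j k)
  rw [Real.mul_self_sqrt (by positivity), mul_comm, Matrix.mulVec_mulVec] at sketch
  rw [gramDefect_eq]
  exact (abs_add_le _ _).trans (add_le_add design sketch)

lemma abs_score_le (hgood : IsGood b bn w ℓ X ξ R θ₀) (hn : 0 < n) (hw : w ^ 2 ≤ n) (hℓ : 0 ≤ ℓ)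
    (hθ₀ : θ₀ ⬝ᵥ θ₀ = 1) (j : Fin p) :
    |((1 / (n : ℝ)) • (R * augmentedDesign w X)ᵀ *ᵥ (R *ᵥ augmentedNoise w ξ θ₀)) j| ≤
      b * bn * (ℓ / √n) + w ^ 2 / n + ℓ / √r * (√(b ^ 2 + 1) * √(bn ^ 2 + 2)) := by
  have split : (R * augmentedDesign w X)ᵀ *ᵥ (R *ᵥ augmentedNoise w ξ θ₀) =
      Xᵀ *ᵥ ξ - w ^ 2 • θ₀ +
        (augmentedDesign w X)ᵀ *ᵥ (Rᵀ * R - 1) *ᵥ augmentedNoise w ξ θ₀ := by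
    rw [Matrix.sub_mulVec, Matrix.one_mulVec, Matrix.mulVec_sub,
      transpose_augmentedDesign_mulVec_augmentedNoise, add_sub_cancel, Matrix.transpose_mul]
    simp only [Matrix.mulVec_mulVec, Matrix.mul_assoc]
  have cross : |1 / (n : ℝ) * (Xᵀ *ᵥ ξ) j| ≤ b * bn * (ℓ / √n) := by
    rw [abs_mul, abs_of_nonneg (by positivity)]
    calc 1 / (n : ℝ) * |(Xᵀ *ᵥ ξ) j| ≤ 1 / n * (b * bn * ℓ * √n) := by
          gcongr; exact hgood.cross j
      _ = b * bn * (ℓ / √n) := by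
          rw [div_eq_mul_one_div ℓ, ← Real.sqrt_div_self']; ring
  have abs_θ₀_le : |θ₀ j| ≤ 1 := by
    rw [← sq_le_one_iff_abs_le_one, sq, ← hθ₀]
    exact Finset.single_le_sum (f := fun j => θ₀ j * θ₀ j) (fun j _ => mul_self_nonneg _)
      (Finset.mem_univ j)
  have shrinkage : |1 / (n : ℝ) * (w ^ 2 * θ₀ j)| ≤ w ^ 2 / n := by
    rw [abs_mul, abs_mul, abs_of_nonneg (by positivity), abs_of_nonneg (sq_nonneg w),
      one_div_mul_eq_div]
    gcongr
    exact mul_le_of_le_one_right (sq_nonneg w) abs_θ₀_le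
  have sketch := hgood.abs_sketch_le hn hw hℓ (hgood.sqrt_noise_le hw hθ₀) (hgood.sketch_noise j)
  rw [split, smul_add, smul_sub]
  exact (abs_add_le _ _).trans
    (add_le_add ((abs_sub _ _).trans (add_le_add cross shrinkage)) sketch)

variable {e N lam : ℝ} {θ : Fin p → ℝ}

lemma sum_abs_sub_le (hgood : IsGood b bn w ℓ X ξ R θ₀) (hn : 0 < n) (hw : w ^ 2 ≤ n)
    (hb : 0 ≤ b) (hbn : 0 ≤ bn) (hℓ : 0 ≤ ℓ) (hlam : 0 ≤ lam) (hθ₀ : θ₀ ⬝ᵥ θ₀ = 1)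
    (he : (b ^ 2 + 1) * (ℓ / √n) + (b ^ 2 + 1) * (ℓ / √r) ≤ e) (hpe : p * e ≤ 1 / 2)
    (hN : b * bn * (ℓ / √n) + w ^ 2 / n + ℓ / √r * (√(b ^ 2 + 1) * √(bn ^ 2 + 2)) ≤ N)
    (hθ : IsPrivateLasso lam w X (X *ᵥ θ₀ + ξ) R θ) :
    ∑ j, |(θ₀ - θ) j| ≤ 4 * p * (N + lam) := by
  have hφ : 1 ≤ phiW n w := le_add_of_nonneg_right (by positivity)
  have hN₀ : 0 ≤ N := le_trans (by positivity) hN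
  have he₀ : 0 ≤ e := le_trans (by positivity) he
  have score (j : Fin p) := (hgood.abs_score_le hn hw hℓ hθ₀ j).trans hN
  have quadratic := half_dotProduct_self_le_of_abs_sub_smul_one_le hφ (by simpa using hpe) he₀
    (fun j k => (hgood.abs_gramDefect_le hn hw hℓ j k).trans he) (θ₀ - θ)
  have basic := basic_inequality_of_lassoObjective_le hlam (hθ θ₀)
  rw [privateY_sub_privateX_mulVec, privateX_eq] at basic
  simpa using sum_abs_le_of_basic_inequality (by positivity) score quadratic basic

lemma norm_bias_le (hgood : IsGood b bn w ℓ X ξ R θ₀) (hn : 0 < n) (hw₀ : 0 ≤ w)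
    (hw : w ^ 2 ≤ n) (hb : 0 ≤ b) (hbn : 0 ≤ bn) (hℓ : 0 ≤ ℓ) (hlam : 0 ≤ lam)
    (hθ₀ : θ₀ ⬝ᵥ θ₀ = 1)
    (he : (b ^ 2 + 1) * (ℓ / √n) + (b ^ 2 + 1) * (ℓ / √r) ≤ e) (hpe : p * e ≤ 1 / 2)
    (hN : b * bn * (ℓ / √n) + w ^ 2 / n + ℓ / √r * (√(b ^ 2 + 1) * √(bn ^ 2 + 2)) ≤ N)
    (hθ : IsPrivateLasso lam w X (X *ᵥ θ₀ + ξ) R θ) :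
    ‖bias w X R θ₀ θ‖ ≤ e * (4 * p * (N + lam)) + ℓ / √r * (√(b ^ 2 + 1) * (√2 * (w / √n))) := by
  have hN₀ : 0 ≤ N := le_trans (by positivity) hN
  have he₀ : 0 ≤ e := le_trans (by positivity) he
  have shift_le : √(augmentedNoise (n := n) w 0 θ₀ ⬝ᵥ augmentedNoise w 0 θ₀) ≤
      √2 * (w / √n) * √n := by
    have hsqrt : √(n : ℝ) ≠ 0 := by positivity
    rw [augmentedNoise_dotProduct_self, hθ₀, zero_dotProduct, zero_add, one_add_one_eq_two,
      mul_comm, Real.sqrt_mul zero_le_two, Real.sqrt_sq hw₀, mul_assoc, div_mul_cancel₀ _ hsqrt]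
  refine (pi_norm_le_iff_of_nonneg (by positivity)).2 fun j => ?_
  rw [bias_eq]
  refine (abs_add_le _ _).trans
    (add_le_add ?_ (hgood.abs_sketch_le hn hw hℓ shift_le (hgood.sketch_shift j)))
  calc |(gramDefect w X R *ᵥ (θ₀ - θ)) j| ≤ e * ∑ k, |(θ₀ - θ) k| :=
        abs_dotProduct_le_mul_sum_abs
          (fun k => (hgood.abs_gramDefect_le hn hw hℓ j k).trans he) (θ₀ - θ)
    _ ≤ e * (4 * p * (N + lam)) := by
        gcongr
        exact hgood.sum_abs_sub_le hn hw hb hbn hℓ hlam hθ₀ he hpe hN hθ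

end IsGood

end Bias

/-! ### Size of the scalar parameters -/

/-- Size relations between the scalar parameters of the private Lasso that hold for all large `p`
and turn the four growth conditions and the bias bound into explicit inequalities. -/
structure Regime (C : ℝ) (p n s r : ℕ) (σ w : ℝ) : Prop where
  C_pos : 0 < C
  one_le_log : 1 ≤ Real.log p
  r_pos : 0 < r
  r_le : r ≤ n
  s_le : s ≤ p
  σ_pos : 0 < σ
  w_pos : 0 < w
  w_sq_le : w ^ 2 ≤ n
  w_sq_div_le : w ^ 2 / n ≤ C * (σ / √r)

namespace Regime

variable {C : ℝ} {p n s r : ℕ} {σ w : ℝ}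

lemma cast_r_pos (h : Regime C p n s r σ w) : (0 : ℝ) < r := Nat.cast_pos.2 h.r_pos

lemma n_pos (h : Regime C p n s r σ w) : 0 < n := h.r_pos.trans_le h.r_le

lemma cast_n_pos (h : Regime C p n s r σ w) : (0 : ℝ) < n := Nat.cast_pos.2 h.n_pos

lemma cast_r_le (h : Regime C p n s r σ w) : (r : ℝ) ≤ n := Nat.cast_le.2 h.r_le

lemma sqrt_r_pos (h : Regime C p n s r σ w) : 0 < √(r : ℝ) := Real.sqrt_pos.2 h.cast_r_pos

lemma sqrt_n_pos (h : Regime C p n s r σ w) : 0 < √(n : ℝ) := Real.sqrt_pos.2 h.cast_n_pos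

lemma log_pos (h : Regime C p n s r σ w) : 0 < Real.log p := zero_lt_one.trans_le h.one_le_log

lemma one_le_p (h : Regime C p n s r σ w) : (1 : ℝ) ≤ p :=
  Nat.one_le_cast.2 (Nat.pos_of_ne_zero fun hp => by simpa [hp] using h.log_pos)

lemma w_div_pos (h : Regime C p n s r σ w) : 0 < w / √n := div_pos h.w_pos h.sqrt_n_pos

lemma w_div_le_one (h : Regime C p n s r σ w) : w / √n ≤ 1 :=
  (div_le_one h.sqrt_n_pos).2 (Real.le_sqrt_of_sq_le h.w_sq_le)

lemma w_sq_div_eq (h : Regime C p n s r σ w) : w ^ 2 / n = (w / √n) ^ 2 := by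
  rw [div_pow, Real.sq_sqrt h.cast_n_pos.le]

lemma sqrt_s_le (h : Regime C p n s r σ w) : √(s : ℝ) ≤ √(p : ℝ) :=
  Real.sqrt_le_sqrt (Nat.cast_le.2 h.s_le)

lemma sqrt_log_le (h : Regime C p n s r σ w) : √(Real.log p) ≤ Real.log p :=
  Real.sqrt_le_left h.log_pos.le |>.2 (le_self_pow₀ h.one_le_log two_ne_zero)

lemma penalty_eq (h : Regime C p n s r σ w) :
    penalty C σ n p r = C * σ * (√(Real.log p ^ 3) / √r) := by
  have := h.log_pos
  have := h.cast_r_pos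
  rw [penalty, max_eq_right, Real.sqrt_div (by positivity)]
  refine Real.sqrt_le_sqrt ?_
  gcongr
  · exact le_self_pow₀ h.one_le_log three_ne_zero
  · exact h.r_le

lemma w_sq_div_le_penalty (h : Regime C p n s r σ w) : w ^ 2 / n ≤ penalty C σ n p r := by
  have := h.C_pos
  have := h.σ_pos
  rw [h.penalty_eq]
  calc w ^ 2 / n ≤ C * σ * (1 / √r) := h.w_sq_div_le.trans_eq (by ring)
    _ ≤ C * σ * (√(Real.log p ^ 3) / √r) := by
        gcongr
        exact Real.one_le_sqrt.2 (one_le_pow₀ h.one_le_log)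

lemma penalty_pos (h : Regime C p n s r σ w) : 0 < penalty C σ n p r :=
  (div_pos (pow_pos h.w_pos 2) h.cast_n_pos).trans_le h.w_sq_div_le_penalty

lemma penalty_le (h : Regime C p n s r σ w) :
    penalty C σ n p r ≤ C * σ * (Real.log p ^ 2 / √r) := by
  have := h.C_pos
  have := h.σ_pos
  rw [h.penalty_eq]
  gcongr
  rw [Real.sqrt_le_left (by positivity), ← pow_mul]
  exact pow_le_pow_right₀ h.one_le_log (by norm_num)

lemma kappa_nonneg (h : Regime C p n s r σ w) : 0 ≤ kappa (penalty C σ n p r) n s w := by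
  have := h.penalty_pos
  rw [kappa]
  positivity

lemma kappa_sq_le (h : Regime C p n s r σ w) :
    kappa (penalty C σ n p r) n s w ^ 2 ≤ 9 * penalty C σ n p r ^ 2 * p := by
  have hlam := h.penalty_pos
  have kappa_le : kappa (penalty C σ n p r) n s w ≤ 3 * penalty C σ n p r * √p :=
    calc kappa (penalty C σ n p r) n s w
        ≤ 2 * penalty C σ n p r * √p + penalty C σ n p r * √p := by
          rw [kappa]
          gcongr
          · exact h.s_le
          · exact h.w_sq_div_le_penalty.trans
              (le_mul_of_one_le_right hlam.le (Real.one_le_sqrt.2 h.one_le_p))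
      _ = 3 * penalty C σ n p r * √p := by ring
  calc kappa (penalty C σ n p r) n s w ^ 2 ≤ (3 * penalty C σ n p r * √p) ^ 2 :=
        pow_le_pow_left₀ h.kappa_nonneg kappa_le 2
    _ = 9 * penalty C σ n p r ^ 2 * p := by
        rw [mul_pow, Real.sq_sqrt p.cast_nonneg]; ring

lemma one_le_phiW (n : ℕ) (w : ℝ) : 1 ≤ phiW n w := le_add_of_nonneg_right (by positivity)

lemma one_div_sqrt_le_rho (h : Regime C p n s r σ w) : 1 / √r ≤ rho n r w := by
  have := h.cast_n_pos
  have := h.cast_r_pos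
  rw [rho, ← Real.sqrt_one, ← Real.sqrt_div zero_le_one, Real.sqrt_one, ← add_div,
    ← mul_div_mul_left 1 (r : ℝ) h.cast_n_pos.ne', mul_one]
  refine Real.sqrt_le_sqrt ?_
  gcongr
  linarith [sq_nonneg w]

lemma inv_noise_nonneg (h : Regime C p n s r σ w) : 0 ≤ 1 / (σ * rho n r w) :=
  one_div_nonneg.2 (mul_nonneg h.σ_pos.le (Real.sqrt_nonneg _))

lemma inv_noise_le (h : Regime C p n s r σ w) : 1 / (σ * rho n r w) ≤ √r / σ := by
  have := h.σ_pos
  have := h.sqrt_r_pos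
  calc 1 / (σ * rho n r w) ≤ 1 / (σ * (1 / √r)) := by
        gcongr
        exact h.one_div_sqrt_le_rho
    _ = √r / σ := by field_simp

/-! ### The four growth conditions -/

lemma sqrt_r_div_log_le (h : Regime C p n s r σ w) : √r / Real.log p ≤ √(r / Real.log p) := by
  rw [Real.sqrt_div h.cast_r_pos.le]
  exact div_le_div_of_nonneg_left h.sqrt_r_pos.le (Real.sqrt_pos.2 h.log_pos) h.sqrt_log_le

lemma sqrt_r_div_log_le_sqrt_n_div_log (h : Regime C p n s r σ w) :
    √r / Real.log p ≤ √(n / Real.log p) :=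
  h.sqrt_r_div_log_le.trans
    (Real.sqrt_le_sqrt (div_le_div_of_nonneg_right h.cast_r_le h.log_pos.le))

lemma sqrt_r_div_log_le_compatibility (h : Regime C p n s r σ w) :
    √r / Real.log p ≤ √((n : ℝ) / Real.log p) *
        min 1 (min √((r : ℝ) / n) (√((r : ℝ) * n) / w ^ 2)) := by
  have := h.log_pos
  have hr := h.cast_r_pos
  have hn := h.cast_n_pos
  have := h.w_pos
  have := h.sqrt_n_pos
  have sqrt_ratio : √((n : ℝ) / Real.log p) * √((r : ℝ) / n) = √(r / Real.log p) := by
    rw [← Real.sqrt_mul (by positivity), div_mul_div_cancel₀' hn.ne']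
  have sqrt_ratio_le : √((r : ℝ) / n) ≤ √((r : ℝ) * n) / w ^ 2 :=
    calc √((r : ℝ) / n) = √((r : ℝ) * n) / n := by
          rw [Real.sqrt_div hr.le, Real.sqrt_mul hr.le, mul_div_assoc, Real.sqrt_div_self]
          rfl
      _ ≤ √((r : ℝ) * n) / w ^ 2 := by gcongr; exact h.w_sq_le
  rw [min_eq_left sqrt_ratio_le, mul_min_of_nonneg _ _ (Real.sqrt_nonneg _), mul_one, sqrt_ratio]
  exact le_min h.sqrt_r_div_log_le_sqrt_n_div_log h.sqrt_r_div_log_le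

lemma compatibility_le (h : Regime C p n s r σ w) :
    kappa (penalty C σ n p r) n s w ^ 2 / (penalty C σ n p r ^ 2 * phiW n w) ≤
      9 * (p * Real.log p ^ 3 / √r) * (√((n : ℝ) / Real.log p) *
        min 1 (min √((r : ℝ) / n) (√((r : ℝ) * n) / w ^ 2))) := by
  have := h.penalty_pos
  have := h.log_pos
  have := h.sqrt_r_pos
  calc kappa (penalty C σ n p r) n s w ^ 2 / (penalty C σ n p r ^ 2 * phiW n w)
      ≤ 9 * penalty C σ n p r ^ 2 * p / (penalty C σ n p r ^ 2 * 1) := by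
        gcongr
        · exact h.kappa_sq_le
        · exact one_le_phiW n w
    _ = 9 * (p : ℝ) * 1 := by field_simp
    _ ≤ 9 * (p : ℝ) * Real.log p ^ 2 := by gcongr; exact one_le_pow₀ h.one_le_log
    _ = 9 * (p * Real.log p ^ 3 / √r) * (√r / Real.log p) := by field_simp
    _ ≤ _ := by gcongr; exact h.sqrt_r_div_log_le_compatibility

lemma sqrt_r_div_le_sparsity (h : Regime C p n s r σ w) :
    √r / (w / √n * Real.log p) ≤ min ((n : ℝ) / w ^ 2 * √((r : ℝ) / Real.log p))
        (√((n : ℝ) * r) / (w * Real.log p)) := by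
  have := h.log_pos
  have hn := h.cast_n_pos
  have := h.sqrt_n_pos
  have := h.w_pos
  have regroup : √r / (w / √n * Real.log p) = √n / w * (√r / Real.log p) := by field_simp
  have one_le_ratio : 1 ≤ √n / w := by
    rw [one_le_div h.w_pos, ← div_le_one h.sqrt_n_pos]
    exact h.w_div_le_one
  refine le_min ?_ (le_of_eq ?_)
  · rw [regroup, ← Real.sq_sqrt hn.le, ← div_pow, Real.sqrt_sq (Real.sqrt_nonneg _)]
    gcongr
    · exact le_self_pow₀ one_le_ratio two_ne_zero
    · exact h.sqrt_r_div_log_le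
  · rw [regroup, Real.sqrt_mul hn.le, div_mul_div_comm]

lemma sparsity_le (h : Regime C p n s r σ w) :
    1 / (σ * rho n r w) * √(s : ℝ) ≤
      1 / σ * (Real.log p * (√p * (w / √n))) * min ((n : ℝ) / w ^ 2 * √((r : ℝ) / Real.log p))
        (√((n : ℝ) * r) / (w * Real.log p)) := by
  have := h.log_pos
  have := h.sqrt_n_pos
  have := h.w_pos
  have := h.σ_pos
  calc 1 / (σ * rho n r w) * √(s : ℝ) ≤ √r / σ * √p :=
        mul_le_mul h.inv_noise_le h.sqrt_s_le (Real.sqrt_nonneg _) (by positivity)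
    _ = 1 / σ * (Real.log p * (√p * (w / √n))) * (√r / (w / √n * Real.log p)) := by field_simp
    _ ≤ _ := by gcongr; exact h.sqrt_r_div_le_sparsity

lemma penalty_level_le (h : Regime C p n s r σ w) (hw : √p * (w / √n) ≤ 1) :
    √(s : ℝ) ≤ max (1 / √(n : ℝ)) (Real.log p / √(r : ℝ)) /
        max (w * Real.log p / √((n : ℝ) * r)) (w ^ 2 / n * √(Real.log p / r)) := by
  have hlog := h.log_pos
  have hn := h.cast_n_pos
  have := h.cast_r_pos
  have := h.sqrt_r_pos
  have := h.sqrt_n_pos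
  have := h.w_pos
  have hratio := h.w_div_pos
  have denominator_le : max (w * Real.log p / √((n : ℝ) * r)) (w ^ 2 / n * √(Real.log p / r)) ≤
      w / √n * (Real.log p / √r) := by
    refine max_le (le_of_eq ?_) ?_
    · rw [Real.sqrt_mul hn.le, mul_div_mul_comm]
    · rw [h.w_sq_div_eq, Real.sqrt_div hlog.le]
      gcongr
      · exact pow_le_of_le_one hratio.le h.w_div_le_one two_ne_zero
      · exact h.sqrt_log_le
  calc √(s : ℝ) ≤ √p := h.sqrt_s_le
    _ ≤ 1 / (w / √n) := (le_div_iff₀ hratio).2 hw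
    _ = Real.log p / √r / (w / √n * (Real.log p / √r)) := by field_simp
    _ ≤ _ := div_le_div₀ (le_max_of_le_left (by positivity)) (le_max_right _ _)
        (lt_max_of_lt_left (by positivity)) denominator_le

lemma error_le (h : Regime C p n s r σ w) :
    1 / (σ * rho n r w) * (4 * kappa (penalty C σ n p r) n s w ^ 2 /
          (penalty C σ n p r * phiW n w)) ≤
      36 * C * (p * Real.log p ^ 3 / √r) * min √((n : ℝ) / Real.log p)
        (min √((r : ℝ) / Real.log p)
          (min ((n : ℝ) / w ^ 2 * √((r : ℝ) / Real.log p))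
            (√((n : ℝ) * r) / (w * Real.log p)))) := by
  have := h.C_pos
  have := h.penalty_pos
  have := h.log_pos
  have := h.sqrt_r_pos
  have := h.σ_pos
  have := h.w_div_pos
  have le_sparsity : √r / Real.log p ≤ √r / (w / √n * Real.log p) := by
    gcongr
    exact mul_le_of_le_one_left h.log_pos.le h.w_div_le_one
  have kappa_ratio_le : 4 * kappa (penalty C σ n p r) n s w ^ 2 / (penalty C σ n p r * phiW n w) ≤
      36 * p * penalty C σ n p r :=
    calc 4 * kappa (penalty C σ n p r) n s w ^ 2 / (penalty C σ n p r * phiW n w)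
        ≤ 4 * (9 * penalty C σ n p r ^ 2 * p) / (penalty C σ n p r * 1) := by
          gcongr
          · exact h.kappa_sq_le
          · exact one_le_phiW n w
      _ = 36 * p * penalty C σ n p r := by field_simp; ring
  calc 1 / (σ * rho n r w) * (4 * kappa (penalty C σ n p r) n s w ^ 2 /
          (penalty C σ n p r * phiW n w))
      ≤ 1 / (σ * rho n r w) * (36 * p * penalty C σ n p r) :=
        mul_le_mul_of_nonneg_left kappa_ratio_le h.inv_noise_nonneg
    _ ≤ √r / σ * (36 * p * (C * σ * (Real.log p ^ 2 / √r))) :=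
        mul_le_mul h.inv_noise_le (mul_le_mul_of_nonneg_left h.penalty_le (by positivity))
          (by positivity) (by positivity)
    _ = 36 * C * (p * Real.log p ^ 3 / √r) * (√r / Real.log p) := by field_simp
    _ ≤ _ := by
        gcongr
        exact le_min h.sqrt_r_div_log_le_sqrt_n_div_log
          (le_min h.sqrt_r_div_log_le (le_sparsity.trans h.sqrt_r_div_le_sparsity))

/-! ### The bias relative to the noise level -/

lemma log_le_sqrt_r (h : Regime C p n s r σ w) (hp : p * Real.log p ^ 3 / √r ≤ 1) :
    Real.log p ≤ √r := by
  have := h.log_pos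
  calc Real.log p ≤ Real.log p ^ 3 := le_self_pow₀ h.one_le_log three_ne_zero
    _ ≤ p * Real.log p ^ 3 := le_mul_of_one_le_left (by positivity) h.one_le_p
    _ ≤ √r := (div_le_one h.sqrt_r_pos).1 hp

lemma log_div_sqrt_n_le (h : Regime C p n s r σ w) : Real.log p / √n ≤ Real.log p / √r :=
  div_le_div_of_nonneg_left h.log_pos.le h.sqrt_r_pos (Real.sqrt_le_sqrt h.cast_r_le)

lemma gram_error_le (h : Regime C p n s r σ w) (b : ℝ) :
    (b ^ 2 + 1) * (Real.log p / √n) + (b ^ 2 + 1) * (Real.log p / √r) ≤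
      2 * (b ^ 2 + 1) * (Real.log p / √r) := by
  linarith [mul_le_mul_of_nonneg_left h.log_div_sqrt_n_le (by positivity : 0 ≤ b ^ 2 + 1)]

lemma sqrt_sq_add_one_le {b : ℝ} (hb : 0 ≤ b) : √(b ^ 2 + 1) ≤ b + 1 :=
  (Real.sqrt_le_left (by positivity)).2 (by linarith [add_sq b 1])

lemma sqrt_sq_add_two_le (h : Regime C p n s r σ w) {bn K : ℝ} (hbn : 0 ≤ bn)
    (hbnK : bn ≤ K * Real.log p) : √(bn ^ 2 + 2) ≤ (K + 2) * Real.log p := by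
  refine (Real.sqrt_le_left (by linarith [h.log_pos])).2 ?_
  nlinarith [pow_le_pow_left₀ hbn hbnK 2, h.one_le_log, hbn.trans hbnK,
    mul_self_nonneg (Real.log p - 1), mul_nonneg (hbn.trans hbnK) h.log_pos.le]

lemma score_le (h : Regime C p n s r σ w) {b bn K : ℝ} (hb : 0 ≤ b) (hbn : 0 ≤ bn)
    (hbnK : bn ≤ K * Real.log p) :
    b * bn * (Real.log p / √n) + w ^ 2 / n +
        Real.log p / √r * (√(b ^ 2 + 1) * √(bn ^ 2 + 2)) ≤
      (b * K + (b + 1) * (K + 2) + C * σ) * (Real.log p ^ 2 / √r) := by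
  have := h.log_pos
  have := h.sqrt_r_pos
  have := h.C_pos
  have := h.σ_pos
  have := hbn.trans hbnK
  have cross : b * bn * (Real.log p / √n) ≤ b * K * (Real.log p ^ 2 / √r) :=
    calc b * bn * (Real.log p / √n) ≤ b * (K * Real.log p) * (Real.log p / √r) := by
          gcongr
          exact h.r_le
      _ = b * K * (Real.log p ^ 2 / √r) := by ring
  have shrinkage : w ^ 2 / n ≤ C * σ * (Real.log p ^ 2 / √r) :=
    h.w_sq_div_le_penalty.trans h.penalty_le
  have sketch : Real.log p / √r * (√(b ^ 2 + 1) * √(bn ^ 2 + 2)) ≤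
      (b + 1) * (K + 2) * (Real.log p ^ 2 / √r) :=
    calc Real.log p / √r * (√(b ^ 2 + 1) * √(bn ^ 2 + 2))
        ≤ Real.log p / √r * ((b + 1) * ((K + 2) * Real.log p)) := by
          gcongr
          · exact sqrt_sq_add_one_le hb
          · exact h.sqrt_sq_add_two_le hbn hbnK
      _ = (b + 1) * (K + 2) * (Real.log p ^ 2 / √r) := by ring
  linarith

variable {b bn K : ℝ} {X : Matrix (Fin n) (Fin p) ℝ} {ξ : Fin n → ℝ}
  {R : Matrix (Fin r) (Fin n ⊕ (Fin p ⊕ Unit)) ℝ} {θ₀ θ : Fin p → ℝ}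

lemma norm_bias_le (h : Regime C p n s r σ w) (hb : 0 ≤ b) (hbn : 0 ≤ bn)
    (hbnK : bn ≤ K * Real.log p) (hp : (b ^ 2 + 1) * (p * Real.log p ^ 3 / √r) ≤ 1 / 4)
    (hgood : IsGood b bn w (Real.log p) X ξ R θ₀) (hθ₀ : θ₀ ⬝ᵥ θ₀ = 1)
    (hθ : IsPrivateLasso (penalty C σ n p r) w X (X *ᵥ θ₀ + ξ) R θ) :
    ‖bias w X R θ₀ θ‖ ≤
      1 / √r * (8 * (b ^ 2 + 1) * (b * K + (b + 1) * (K + 2) + 2 * C * σ) *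
          (p * Real.log p ^ 3 / √r) + 2 * (b + 1) * (Real.log p * (√p * (w / √n)))) := by
  have hℓ := h.log_pos
  have := h.sqrt_r_pos
  have hw := h.w_div_pos
  have hpe : p * (2 * (b ^ 2 + 1) * (Real.log p / √r)) ≤ 1 / 2 :=
    calc p * (2 * (b ^ 2 + 1) * (Real.log p / √r))
        ≤ p * (2 * (b ^ 2 + 1) * (Real.log p ^ 3 / √r)) := by
          gcongr
          exact le_self_pow₀ h.one_le_log three_ne_zero
      _ = 2 * ((b ^ 2 + 1) * (p * Real.log p ^ 3 / √r)) := by ring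
      _ ≤ 1 / 2 := by linarith
  have sketch_le : Real.log p / √r * (√(b ^ 2 + 1) * (√2 * (w / √n))) ≤
      Real.log p / √r * ((b + 1) * (2 * (√p * (w / √n)))) := by
    gcongr
    · exact sqrt_sq_add_one_le hb
    · exact (Real.sqrt_le_left zero_le_two).2 (by norm_num)
    · exact le_mul_of_one_le_left hw.le (Real.one_le_sqrt.2 h.one_le_p)
  calc ‖bias w X R θ₀ θ‖
      ≤ 2 * (b ^ 2 + 1) * (Real.log p / √r) * (4 * p *
            ((b * K + (b + 1) * (K + 2) + C * σ) * (Real.log p ^ 2 / √r) + penalty C σ n p r)) +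
          Real.log p / √r * (√(b ^ 2 + 1) * (√2 * (w / √n))) :=
        hgood.norm_bias_le h.n_pos h.w_pos.le h.w_sq_le hb hbn hℓ.le h.penalty_pos.le hθ₀
          (h.gram_error_le b) hpe (h.score_le hb hbn hbnK) hθ
    _ ≤ 2 * (b ^ 2 + 1) * (Real.log p / √r) * (4 * p *
            ((b * K + (b + 1) * (K + 2) + C * σ) * (Real.log p ^ 2 / √r) +
              C * σ * (Real.log p ^ 2 / √r))) +
          Real.log p / √r * ((b + 1) * (2 * (√p * (w / √n)))) := by
        gcongr
        exact h.penalty_le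
    _ = _ := by ring

lemma norm_bias_div_le (h : Regime C p n s r σ w) (hb : 0 ≤ b) (hbn : 0 ≤ bn)
    (hbnK : bn ≤ K * Real.log p) (hp : (b ^ 2 + 1) * (p * Real.log p ^ 3 / √r) ≤ 1 / 4)
    (hgood : IsGood b bn w (Real.log p) X ξ R θ₀) (hθ₀ : θ₀ ⬝ᵥ θ₀ = 1)
    (hθ : IsPrivateLasso (penalty C σ n p r) w X (X *ᵥ θ₀ + ξ) R θ) :
    ‖bias w X R θ₀ θ‖ / (σ * rho n r w) ≤
      8 * (b ^ 2 + 1) * ((b * K + (b + 1) * (K + 2)) / σ + 2 * C) * (p * Real.log p ^ 3 / √r) +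
        2 * (b + 1) / σ * (Real.log p * (√p * (w / √n))) := by
  have := h.σ_pos
  have := h.sqrt_r_pos
  rw [div_eq_mul_one_div]
  have norm_le := h.norm_bias_le hb hbn hbnK hp hgood hθ₀ hθ
  refine (mul_le_mul norm_le h.inv_noise_le h.inv_noise_nonneg
    ((norm_nonneg _).trans norm_le)).trans_eq ?_
  field_simp

end Regime

/-! ### Asymptotics of the parameters -/

lemma tendsto_log_natCast : Tendsto (fun p : ℕ => Real.log p) atTop atTop :=
  Real.tendsto_log_atTop.comp tendsto_natCast_atTop_atTop

lemma eventually_one_le_log : ∀ᶠ p : ℕ in atTop, 1 ≤ Real.log p :=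
  tendsto_log_natCast.eventually_ge_atTop 1

lemma isLittleO_log_pow_rpow (k : ℕ) {c : ℝ} (hc : 0 < c) :
    (fun p : ℕ => Real.log p ^ k) =o[atTop] fun p : ℕ => (p : ℝ) ^ c := by
  simpa only [Real.rpow_natCast, Function.comp_def] using
    (isLittleO_log_rpow_rpow_atTop (k : ℝ) hc).comp_tendsto tendsto_natCast_atTop_atTop

lemma isLittleO_rpow_natCast {a c : ℝ} (h : a < c) :
    (fun p : ℕ => (p : ℝ) ^ a) =o[atTop] fun p : ℕ => (p : ℝ) ^ c := by
  refine (isLittleO_iff_tendsto' ?_).2 ?_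
  · filter_upwards [eventually_gt_atTop 0] with p hp hpc
    exact absurd hpc (Real.rpow_pos_of_pos (Nat.cast_pos.2 hp) c).ne'
  · refine ((tendsto_rpow_neg_atTop (sub_pos.2 h)).comp tendsto_natCast_atTop_atTop).congr' ?_
    filter_upwards [eventually_gt_atTop 0] with p hp
    rw [Function.comp_apply, neg_sub, Real.rpow_sub (Nat.cast_pos.2 hp)]

lemma isLittleO_const_log_natCast {c : ℝ} :
    (fun _ : ℕ => c) =o[atTop] fun p : ℕ => Real.log p :=
  Real.isLittleO_const_log_atTop.comp_tendsto tendsto_natCast_atTop_atTop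

lemma isBigO_log_of_isBigO_rpow {α : ℝ} {n : ℕ → ℕ}
    (hn : (fun p => (n p : ℝ)) =O[atTop] fun p : ℕ => (p : ℝ) ^ α) :
    (fun p => Real.log (n p)) =O[atTop] fun p : ℕ => Real.log p := by
  obtain ⟨c, hc, hn⟩ := hn.exists_pos
  have log_le : ∀ᶠ p in atTop, ‖Real.log (n p)‖ ≤ ‖Real.log c + α * Real.log p‖ := by
    filter_upwards [hn.bound, eventually_gt_atTop 0] with p hnp hp
    have hp : (0 : ℝ) < p := Nat.cast_pos.2 hp
    rcases (n p).eq_zero_or_pos with hn₀ | hn₀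
    · simp [hn₀]
    · rw [← Real.log_rpow hp, ← Real.log_mul hc.ne' (by positivity)]
      refine (abs_of_nonneg (Real.log_natCast_nonneg _)).trans_le (le_trans ?_ (le_abs_self _))
      refine Real.log_le_log (Nat.cast_pos.2 hn₀) ?_
      simpa [abs_of_pos (Real.rpow_pos_of_pos hp α)] using hnp
  exact (IsBigO.of_norm_eventuallyLE log_le).of_norm_right.trans
    (isLittleO_const_log_natCast.isBigO.add ((isBigO_refl _ _).const_mul_left α))

/-- The number `⌈p ^ (2 + τ)⌉` of rows of the random projection. Its exponent exceeds `2` so that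
the private Gram matrix has entrywise error `o(1 / p)`. -/
noncomputable def projDim (τ : ℝ) (p : ℕ) : ℕ := ⌈(p : ℝ) ^ (2 + τ)⌉₊

section ProjDim

variable {τ : ℝ}

lemma tendsto_rpow_two_add (hτ : 0 < τ) :
    Tendsto (fun p : ℕ => (p : ℝ) ^ (2 + τ)) atTop atTop :=
  (tendsto_rpow_atTop (by positivity)).comp tendsto_natCast_atTop_atTop

lemma tendsto_projDim (hτ : 0 < τ) : Tendsto (projDim τ) atTop atTop :=
  tendsto_nat_ceil_atTop.comp (tendsto_rpow_two_add hτ)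

lemma isTheta_projDim (hτ : 0 < τ) :
    (fun p => (projDim τ p : ℝ)) =Θ[atTop] fun p : ℕ => (p : ℝ) ^ (2 + τ) :=
  (isEquivalent_nat_ceil.comp_tendsto (tendsto_rpow_two_add hτ)).isTheta

lemma eventually_projDim_le (hτ : 0 < τ) {α : ℝ} (hτα : 2 + τ < α) {n : ℕ → ℕ}
    (hn : (fun p : ℕ => (p : ℝ) ^ α) =O[atTop] fun p => (n p : ℝ)) :
    ∀ᶠ p in atTop, projDim τ p ≤ n p := by
  have isLittleO_n : (fun p => (projDim τ p : ℝ)) =o[atTop] fun p => (n p : ℝ) :=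
    ((isTheta_projDim hτ).isBigO.trans_isLittleO (isLittleO_rpow_natCast hτα)).trans_isBigO hn
  filter_upwards [isLittleO_n.eventuallyLE] with p hp
  simpa using hp

lemma tendsto_mul_log_pow_div_sqrt_projDim (hτ : 0 < τ) :
    Tendsto (fun p : ℕ => p * Real.log p ^ 3 / √(projDim τ p : ℝ)) atTop (𝓝 0) := by
  have sqrt_projDim := ((isTheta_projDim hτ).sqrt (Eventually.of_forall fun p => by positivity)
    (Eventually.of_forall fun p => by positivity)).symm.isBigO
  refine IsLittleO.tendsto_div_nhds_zero (IsLittleO.trans_isBigO ?_ sqrt_projDim)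
  refine ((isBigO_refl (fun p : ℕ => (p : ℝ)) atTop).mul_isLittleO
    (isLittleO_log_pow_rpow 3 (half_pos hτ))).trans_eventuallyEq ?_
  filter_upwards [eventually_gt_atTop 0] with p hp
  have hp : (0 : ℝ) < p := Nat.cast_pos.2 hp
  rw [Real.sqrt_eq_rpow, ← Real.rpow_mul hp.le, ← Real.rpow_one_add' hp.le (by positivity)]
  ring_nf

end ProjDim

lemma isBigO_log_four_div {δ : ℕ → ℝ} (hδ : ∀ p, 0 < δ p)
    (h : (fun p => Real.log (1 / δ p)) =O[atTop] fun p : ℕ => Real.log p) :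
    (fun p => Real.log (4 / δ p)) =O[atTop] fun p : ℕ => Real.log p := by
  have split (p : ℕ) : Real.log (4 / δ p) = Real.log 4 + Real.log (1 / δ p) := by
    rw [← Real.log_mul four_ne_zero (one_div_pos.2 (hδ p)).ne', mul_one_div]
  simp only [split]
  exact isLittleO_const_log_natCast.isBigO.add h

lemma isBigO_truncation {α : ℝ} {n : ℕ → ℕ}
    (hn : (fun p => (n p : ℝ)) =O[atTop] fun p : ℕ => (p : ℝ) ^ α) {σ bn : ℕ → ℝ}
    (hσ : σ =O[atTop] fun _ => (1 : ℝ))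
    (hbn : bn =O[atTop] fun p => σ p * √(Real.log (n p))) :
    bn =O[atTop] fun p : ℕ => Real.log p := by
  have log_nonneg : 0 ≤ᶠ[atTop] fun p : ℕ => Real.log p :=
    Eventually.of_forall fun p => Real.log_natCast_nonneg p
  have sqrt_log : (fun p : ℕ => √(Real.log p)) =O[atTop] fun p : ℕ => Real.log p := by
    refine IsBigO.of_norm_eventuallyLE ?_
    filter_upwards [eventually_one_le_log] with p hp
    rw [Real.norm_of_nonneg (Real.sqrt_nonneg _), Real.sqrt_le_left (by positivity)]
    exact le_self_pow₀ hp two_ne_zero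
  simpa only [one_mul] using
    hbn.trans (hσ.mul (((isBigO_log_of_isBigO_rpow hn).sqrt log_nonneg).trans sqrt_log))

lemma isBigO_rowBound_sq {s₀ : ℕ → ℕ} (b : ℝ) {bn : ℕ → ℝ} (hs : ∀ᶠ p in atTop, s₀ p ≤ p)
    (hbn : bn =O[atTop] fun p : ℕ => Real.log p) :
    (fun p => rowBound p (s₀ p) b (bn p) ^ 2) =O[atTop] fun p : ℕ => (p : ℝ) := by
  have hsqrt : (fun p => √(s₀ p : ℝ)) =O[atTop] fun p : ℕ => √(p : ℝ) :=
    IsBigO.of_norm_eventuallyLE <| hs.mono fun p hp =>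
      (Real.norm_of_nonneg (Real.sqrt_nonneg _)).trans_le (Real.sqrt_le_sqrt (Nat.cast_le.2 hp))
  have hlog : (fun p : ℕ => Real.log p) =O[atTop] fun p : ℕ => √(p : ℝ) := by
    simpa only [pow_one, ← Real.sqrt_eq_rpow] using (isLittleO_log_pow_rpow 1 one_half_pos).isBigO
  have hnoise := ((hsqrt.const_mul_left b).add (hbn.trans hlog)).pow 2
  have hdesign := (isBigO_refl (fun p : ℕ => (p : ℝ)) atTop).const_mul_left (2 * b ^ 2)
  simp only [Real.sq_sqrt (Nat.cast_nonneg _)] at hnoise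
  refine (hdesign.add hnoise).congr_left fun p => ?_
  rw [rowBound, Real.sq_sqrt (by positivity)]
  ring

lemma rowBound_pos {p : ℕ} (hp : 0 < p) (s₀ : ℕ) {b : ℝ} (hb : 0 < b) (bn : ℝ) :
    0 < rowBound p s₀ b bn := by
  rw [rowBound]
  positivity

lemma one_le_log_four_div {δ : ℝ} (hδ : 0 < δ) (hδ₁ : δ < 1) : 1 ≤ Real.log (4 / δ) := by
  rw [Real.le_log_iff_exp_le (by positivity)]
  calc Real.exp 1 ≤ 4 := by linarith [Real.exp_one_lt_d9]
    _ ≤ 4 / δ := le_div_self zero_le_four hδ hδ₁.le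

lemma privacyW_pos {B ε δ : ℝ} (hB : 0 < B) (hε : 0 < ε) (hδ : 0 < δ) (hδ₁ : δ < 1) (r : ℕ) :
    0 < privacyW B ε δ r := by
  have := zero_lt_one.trans_le (one_le_log_four_div hδ hδ₁)
  rw [privacyW]
  positivity

lemma sqrt_mul_privacyW_sq_le (B : ℝ) {ε δ : ℝ} (hε : 0 < ε) (hδ : 0 < δ) (hδ₁ : δ < 1) {r : ℕ}
    (hr : 0 < r) : √r * privacyW B ε δ r ^ 2 ≤ 12 * (B ^ 2 / ε * (r * Real.log (4 / δ))) := by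
  have hL := one_le_log_four_div hδ hδ₁
  set L := Real.log (4 / δ)
  have sqrt_le : √(2 * r * L) ≤ √r * (2 * L) := by
    rw [mul_assoc, mul_left_comm, Real.sqrt_mul r.cast_nonneg]
    gcongr
    exact (Real.sqrt_le_left (by positivity)).2 (le_self_pow₀ (by linarith) two_ne_zero)
  have le_sqrt_mul : L ≤ √r * L :=
    le_mul_of_one_le_left (by positivity) (Real.one_le_sqrt.2 (Nat.one_le_cast.2 hr))
  rw [privacyW, Real.sq_sqrt (by positivity)]
  calc √r * (4 * B ^ 2 / ε * (√(2 * r * L) + L))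
      ≤ √r * (4 * B ^ 2 / ε * (√r * (2 * L) + √r * L)) := by gcongr
    _ = 12 * (B ^ 2 / ε * (√r * √r * L)) := by ring
    _ = 12 * (B ^ 2 / ε * (r * L)) := by rw [Real.mul_self_sqrt r.cast_nonneg]

lemma tendsto_sqrt_projDim_mul {α γ τ : ℝ} (hτ : 0 < τ) (hτγ : 2 * τ ≤ α + γ - 3)
    {n : ℕ → ℕ} (hn : (fun p : ℕ => (p : ℝ) ^ α) =O[atTop] fun p => (n p : ℝ)) {δ : ℕ → ℝ}
    (hδ : ∀ p, 0 < δ p ∧ δ p < 1)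
    (hδO : (fun p => Real.log (1 / δ p)) =O[atTop] fun p : ℕ => Real.log p) {B : ℕ → ℝ}
    (hB : (fun p => B p ^ 2) =O[atTop] fun p : ℕ => (p : ℝ)) :
    Tendsto (fun p : ℕ => √(projDim τ p : ℝ) *
      (privacyW (B p) ((p : ℝ) ^ γ) (δ p) (projDim τ p) ^ 2 / n p)) atTop (𝓝 0) := by
  have w_sq_le : ∀ᶠ p : ℕ in atTop,
      ‖√(projDim τ p : ℝ) * privacyW (B p) ((p : ℝ) ^ γ) (δ p) (projDim τ p) ^ 2‖ ≤
        12 * (B p ^ 2 / (p : ℝ) ^ γ * (projDim τ p * Real.log (4 / δ p))) := by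
    filter_upwards [eventually_gt_atTop 0, (tendsto_projDim hτ).eventually_gt_atTop 0] with p hp hr
    rw [Real.norm_of_nonneg (by positivity)]
    exact sqrt_mul_privacyW_sq_le (B p) (Real.rpow_pos_of_pos (Nat.cast_pos.2 hp) γ) (hδ p).1
      (hδ p).2 hr
  have power_le : (fun p : ℕ => (p : ℝ) / (p : ℝ) ^ γ * ((p : ℝ) ^ (2 + τ) * (p : ℝ) ^ τ))
      =O[atTop] fun p : ℕ => (p : ℝ) ^ α := by
    refine IsBigO.of_norm_eventuallyLE ?_
    filter_upwards [eventually_gt_atTop 0] with p hp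
    have hp₀ : (0 : ℝ) < p := Nat.cast_pos.2 hp
    rw [Real.norm_of_nonneg (by positivity)]
    calc (p : ℝ) / (p : ℝ) ^ γ * ((p : ℝ) ^ (2 + τ) * (p : ℝ) ^ τ)
        = (p : ℝ) ^ (1 - γ + (2 + τ + τ)) := by
          rw [Real.rpow_add hp₀ (1 - γ), Real.rpow_add hp₀ (2 + τ), Real.rpow_sub hp₀,
            Real.rpow_one]
      _ ≤ (p : ℝ) ^ α := Real.rpow_le_rpow_of_exponent_le (Nat.one_le_cast.2 hp) (by linarith)
  have hlog : (fun p => Real.log (4 / δ p)) =o[atTop] fun p : ℕ => (p : ℝ) ^ τ :=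
    (isBigO_log_four_div (fun p => (hδ p).1) hδO).trans_isLittleO
      (by simpa only [pow_one] using isLittleO_log_pow_rpow 1 hτ)
  have hlim := ((hB.mul (isBigO_refl (fun p : ℕ => ((p : ℝ) ^ γ)⁻¹) atTop)).mul_isLittleO
    ((isTheta_projDim hτ).isBigO.mul_isLittleO hlog)).trans_isBigO (power_le.trans hn)
  simpa only [mul_div_assoc] using ((IsBigO.of_norm_eventuallyLE w_sq_le).trans_isLittleO
    (hlim.const_mul_left 12)).tendsto_div_nhds_zero

lemma tendsto_log_mul_sqrt_mul {n r : ℕ → ℕ} {w : ℕ → ℝ} (hw : ∀ᶠ p in atTop, 0 < w p)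
    (hr : ∀ᶠ p in atTop, 0 < r p)
    (hlog : Tendsto (fun p : ℕ => p * Real.log p ^ 3 / √(r p : ℝ)) atTop (𝓝 0))
    (hwn : Tendsto (fun p : ℕ => √(r p : ℝ) * (w p ^ 2 / n p)) atTop (𝓝 0)) :
    Tendsto (fun p : ℕ => Real.log p * (√p * (w p / √(n p)))) atTop (𝓝 0) := by
  have hlim := (hlog.mul hwn).sqrt
  rw [mul_zero, Real.sqrt_zero] at hlim
  refine squeeze_zero' ?_ ?_ hlim
  · filter_upwards [hw] with p hw
    have := Real.log_natCast_nonneg p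
    positivity
  · filter_upwards [hr, eventually_one_le_log] with p hr hℓ
    have : 0 < √(r p : ℝ) := Real.sqrt_pos.2 (Nat.cast_pos.2 hr)
    apply Real.le_sqrt_of_sq_le
    calc (Real.log p * (√p * (w p / √(n p)))) ^ 2 = p * Real.log p ^ 2 * (w p ^ 2 / n p) := by
          rw [mul_pow, mul_pow, div_pow, Real.sq_sqrt (Nat.cast_nonneg _),
            Real.sq_sqrt (Nat.cast_nonneg _)]
          ring
      _ ≤ p * Real.log p ^ 3 * (w p ^ 2 / n p) := by
          gcongr
          norm_num
      _ = p * Real.log p ^ 3 / √(r p : ℝ) * (√(r p : ℝ) * (w p ^ 2 / n p)) := by field_simp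

lemma eventually_regime {C σ₁ : ℝ} (hC : 0 < C) (hσ₁ : 0 < σ₁) {n s₀ r : ℕ → ℕ} {σ w : ℕ → ℝ}
    (hσ : ∀ᶠ p in atTop, σ₁ ≤ σ p) (hr : ∀ᶠ p in atTop, 0 < r p)
    (hrn : ∀ᶠ p in atTop, r p ≤ n p) (hs : ∀ᶠ p in atTop, s₀ p ≤ p)
    (hw : ∀ᶠ p in atTop, 0 < w p)
    (hwn : Tendsto (fun p : ℕ => √(r p : ℝ) * (w p ^ 2 / n p)) atTop (𝓝 0)) :
    ∀ᶠ p in atTop, Regime C p (n p) (s₀ p) (r p) (σ p) (w p) := by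
  filter_upwards [hσ, hr, hrn, hs, hw, hwn.eventually_le_const one_pos,
    hwn.eventually_le_const (mul_pos hC hσ₁), eventually_one_le_log]
    with p hσ hr hrn hs hw w_sq_le_one w_sq_le hℓ
  have one_le_sqrt : 1 ≤ √(r p : ℝ) := Real.one_le_sqrt.2 (Nat.one_le_cast.2 hr)
  refine ⟨hC, hℓ, hr, hrn, hs, hσ₁.trans_le hσ, hw, ?_, ?_⟩
  · rw [← div_le_one (Nat.cast_pos.2 (hr.trans_le hrn))]
    exact (le_mul_of_one_le_left (by positivity) one_le_sqrt).trans w_sq_le_one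
  · rw [← mul_div_assoc, le_div_iff₀ (zero_lt_one.trans_le one_le_sqrt), mul_comm]
    exact w_sq_le.trans (mul_le_mul_of_nonneg_left hσ hC.le)

lemma isLittleO_of_le_mul {f g ε : ℕ → ℝ} (hε : Tendsto ε atTop (𝓝 0))
    (hf : ∀ᶠ p in atTop, 0 ≤ f p) (h : ∀ᶠ p in atTop, f p ≤ ε p * g p) : f =o[atTop] g := by
  have f_le : ∀ᶠ p in atTop, ‖f p‖ ≤ ‖ε p * g p‖ := by
    filter_upwards [hf, h] with p hf h
    exact (Real.norm_of_nonneg hf).trans_le (h.trans (le_abs_self _))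
  simpa only [one_mul] using (IsBigO.of_norm_eventuallyLE f_le).of_norm_right.trans_isLittleO
    (((isLittleO_one_iff ℝ).2 hε).mul_isBigO (isBigO_refl g atTop))

theorem sufficientConditions_of_regime {C σ₁ : ℝ} (hσ₁ : 0 < σ₁) {n s₀ r : ℕ → ℕ} {σ w : ℕ → ℝ}
    (hσ : ∀ᶠ p in atTop, σ₁ ≤ σ p)
    (hreg : ∀ᶠ p in atTop, Regime C p (n p) (s₀ p) (r p) (σ p) (w p))
    (hlog : Tendsto (fun p : ℕ => p * Real.log p ^ 3 / √(r p : ℝ)) atTop (𝓝 0))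
    (hwn : Tendsto (fun p : ℕ => Real.log p * (√p * (w p / √(n p)))) atTop (𝓝 0)) :
    SufficientConditions C σ n s₀ r w where
  compatibility := by
    refine isLittleO_of_le_mul (by simpa using hlog.const_mul 9) ?_
      (hreg.mono fun p h => h.compatibility_le)
    filter_upwards with p
    have := zero_le_one.trans (Regime.one_le_phiW (n p) (w p))
    positivity
  penalty_level := by
    refine IsBigO.of_norm_eventuallyLE ?_ |>.of_norm_right
    filter_upwards [hreg, hwn.eventually_le_const one_pos] with p h hwn
    have sqrt_le : √p * (w p / √(n p)) ≤ 1 :=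
      (le_mul_of_one_le_left (mul_nonneg (Real.sqrt_nonneg _) h.w_div_pos.le) h.one_le_log).trans
        hwn
    exact (Real.norm_of_nonneg (Real.sqrt_nonneg _)).trans_le
      ((h.penalty_level_le sqrt_le).trans (le_abs_self _))
  sparsity := by
    refine isLittleO_of_le_mul (ε := fun p => 1 / σ₁ * (Real.log p * (√p * (w p / √(n p)))))
      (by simpa using hwn.const_mul (1 / σ₁)) ?_ ?_
    · exact hreg.mono fun p h => mul_nonneg h.inv_noise_nonneg (Real.sqrt_nonneg _)
    · filter_upwards [hreg, hσ] with p h hσ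
      have := h.w_pos
      have := h.log_pos
      refine h.sparsity_le.trans ?_
      gcongr
  error := by
    refine isLittleO_of_le_mul (by simpa using hlog.const_mul (36 * C)) ?_
      (hreg.mono fun p h => h.error_le)
    filter_upwards [hreg] with p h
    have := zero_le_one.trans (Regime.one_le_phiW (n p) (w p))
    have := h.penalty_pos
    have := h.inv_noise_nonneg
    positivity

/-! ### Smallness of the bias in probability -/

lemma pos_of_variance_eq_one {D : Measure ℝ} {b : ℝ} (hD : ∀ᵐ x ∂D, |x| ≤ b)
    (h₁ : variance id D = 1) : 0 < b := by
  by_contra! hb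
  have id_eq_zero : id =ᵐ[D] 0 := hD.mono fun x hx => abs_nonpos_iff.1 (hx.trans hb)
  rw [variance_congr id_eq_zero, variance_zero] at h₁
  exact zero_ne_one h₁

lemma tendsto_mul_exp_neg_log_sq :
    Tendsto (fun p : ℕ => (2 * (p : ℝ) ^ 2 + 3 * p) * (4 * Real.exp (-(Real.log p ^ 2 / 16))))
      atTop (𝓝 0) := by
  have hlim : Tendsto (fun p : ℕ => 20 * Real.exp (-Real.log p)) atTop (𝓝 0) := by
    simpa using (Real.tendsto_exp_neg_atTop_nhds_zero.comp tendsto_log_natCast).const_mul 20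
  refine squeeze_zero' (Eventually.of_forall fun p => by positivity) ?_ hlim
  filter_upwards [tendsto_log_natCast.eventually_ge_atTop 48, eventually_gt_atTop 0] with p hℓ hp
  have sq_eq_exp : (p : ℝ) ^ 2 = Real.exp (2 * Real.log p) := by
    rw [two_mul, Real.exp_add, Real.exp_log (Nat.cast_pos.2 hp), sq]
  have le_sq : (p : ℝ) ≤ (p : ℝ) ^ 2 := le_self_pow₀ (Nat.one_le_cast.2 hp) two_ne_zero
  calc (2 * (p : ℝ) ^ 2 + 3 * p) * (4 * Real.exp (-(Real.log p ^ 2 / 16)))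
      ≤ 5 * (p : ℝ) ^ 2 * (4 * Real.exp (-(Real.log p ^ 2 / 16))) := by gcongr; linarith
    _ = 20 * Real.exp (2 * Real.log p + -(Real.log p ^ 2 / 16)) := by
        rw [sq_eq_exp, Real.exp_add]; ring
    _ ≤ 20 * Real.exp (-Real.log p) := by gcongr; nlinarith

section BiasInProbability

variable {C σ₁ b : ℝ} {n s₀ r : ℕ → ℕ} {σ bn w : ℕ → ℝ}

lemma eventually_norm_bias_div_le (hb : 0 ≤ b) (hσ₁ : 0 < σ₁) (hσ : ∀ᶠ p in atTop, σ₁ ≤ σ p)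
    (hbn : ∀ᶠ p in atTop, 0 < bn p) (hbnO : bn =O[atTop] fun p : ℕ => Real.log p)
    (hreg : ∀ᶠ p in atTop, Regime C p (n p) (s₀ p) (r p) (σ p) (w p))
    (hlog : Tendsto (fun p : ℕ => p * Real.log p ^ 3 / √(r p : ℝ)) atTop (𝓝 0))
    (hwn : Tendsto (fun p : ℕ => Real.log p * (√p * (w p / √(n p)))) atTop (𝓝 0))
    {η : ℝ} (hη : 0 < η) :
    ∀ᶠ p in atTop, ∀ (X : Matrix (Fin (n p)) (Fin p) ℝ) (ξ : Fin (n p) → ℝ)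
      (R : Matrix (Fin (r p)) (Fin (n p) ⊕ (Fin p ⊕ Unit)) ℝ) (θ₀ θ : Fin p → ℝ),
      IsGood b (bn p) (w p) (Real.log p) X ξ R θ₀ → θ₀ ⬝ᵥ θ₀ = 1 →
      IsPrivateLasso (penalty C (σ p) (n p) p (r p)) (w p) X (X *ᵥ θ₀ + ξ) R θ →
      ‖bias (w p) X R θ₀ θ‖ / (σ p * rho (n p) (r p) (w p)) ≤ η := by
  obtain ⟨K, hK, hbnK⟩ := hbnO.exists_nonneg
  have hlim : Tendsto (fun p : ℕ =>
      8 * (b ^ 2 + 1) * ((b * K + (b + 1) * (K + 2)) / σ₁ + 2 * C) *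
          (p * Real.log p ^ 3 / √(r p : ℝ)) +
        2 * (b + 1) / σ₁ * (Real.log p * (√p * (w p / √(n p))))) atTop (𝓝 0) := by
    simpa using (hlog.const_mul _).add (hwn.const_mul _)
  have hgram := hlog.const_mul (b ^ 2 + 1)
  rw [mul_zero] at hgram
  filter_upwards [hreg, hσ, hbn, hbnK.bound, hlim.eventually_le_const hη,
    hgram.eventually_le_const (by norm_num : (0 : ℝ) < 1 / 4)]
    with p h hσ hbn hbnK hlim hgram X ξ R θ₀ θ hgood hθ₀ hθ
  have hw := h.w_div_pos
  have hℓ := h.log_pos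
  rw [Real.norm_of_nonneg hbn.le, Real.norm_of_nonneg hℓ.le] at hbnK
  refine (h.norm_bias_div_le hb hbn.le hbnK hgram hgood hθ₀ hθ).trans (le_trans ?_ hlim)
  gcongr

theorem tendsto_measure_lt_norm_bias_div {D : Measure ℝ} (hD : ∀ᵐ x ∂D, |x| ≤ b)
    (h₀ : ∫ x, x ∂D = 0) (h₁ : variance id D = 1) (hσ₁ : 0 < σ₁) (hσ : ∀ᶠ p in atTop, σ₁ ≤ σ p)
    (hbn : ∀ᶠ p in atTop, 0 < bn p) (hbnO : bn =O[atTop] fun p : ℕ => Real.log p)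
    (hreg : ∀ᶠ p in atTop, Regime C p (n p) (s₀ p) (r p) (σ p) (w p))
    (hlog : Tendsto (fun p : ℕ => p * Real.log p ^ 3 / √(r p : ℝ)) atTop (𝓝 0))
    (hwn : Tendsto (fun p : ℕ => Real.log p * (√p * (w p / √(n p)))) atTop (𝓝 0))
    {Ω : ℕ → Type*} [∀ p, MeasurableSpace (Ω p)] {μ : ∀ p, Measure (Ω p)}
    [∀ p, IsProbabilityMeasure (μ p)] {X : ∀ p, Ω p → Matrix (Fin (n p)) (Fin p) ℝ}
    {ξ : ∀ p, Ω p → Fin (n p) → ℝ}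
    {R : ∀ p, Ω p → Matrix (Fin (r p)) (Fin (n p) ⊕ (Fin p ⊕ Unit)) ℝ} {θ₀ : ∀ p, Fin p → ℝ}
    {θ : ∀ p, Ω p → Fin p → ℝ}
    (hM : ∀ᶠ p in atTop, IsModel (μ p) D (σ p) (bn p) (X p) (ξ p) (R p))
    (hθ₀ : ∀ᶠ p in atTop, ∑ j, θ₀ p j ^ 2 = 1)
    (hθ : ∀ᶠ p in atTop, ∀ᵐ ω ∂μ p, IsPrivateLasso (penalty C (σ p) (n p) p (r p)) (w p) (X p ω)
      (X p ω *ᵥ θ₀ p + ξ p ω) (R p ω) (θ p ω)) {η : ℝ} (hη : 0 < η) :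
    Tendsto (fun p => μ p {ω | η < ‖bias (w p) (X p ω) (R p ω) (θ₀ p) (θ p ω)‖ /
      (σ p * rho (n p) (r p) (w p))}) atTop (𝓝 0) := by
  have hb := pos_of_variance_eq_one hD h₁
  have hfail := ENNReal.tendsto_ofReal tendsto_mul_exp_neg_log_sq
  rw [ENNReal.ofReal_zero] at hfail
  refine tendsto_of_tendsto_of_tendsto_of_le_of_le' tendsto_const_nhds hfail
    (Eventually.of_forall fun p => zero_le) ?_
  filter_upwards [hM, hθ₀, hθ, hreg, hbn, hlog.eventually_le_const one_pos,
    eventually_norm_bias_div_le hb.le hσ₁ hσ hbn hbnO hreg hlog hwn hη]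
    with p hM hθ₀ hθ h hbn hlog norm_le
  have hθ₀ : θ₀ p ⬝ᵥ θ₀ p = 1 := by simpa only [dotProduct, ← sq] using hθ₀
  refine le_trans (measure_mono_ae ?_) (ENNReal.le_ofReal_iff_toReal_le (measure_ne_top _ _)
    (by positivity) |>.2 (hM.measureReal_not_isGood_le h.n_pos h.r_pos hb hbn h.log_pos.le
      (h.log_le_sqrt_r hlog) hD h₀ h₁ (w p) (θ₀ p)))
  filter_upwards [hθ] with ω hω hbad hgood
  exact (norm_le _ _ _ _ _ hgood hθ₀ hω).not_gt hbad

end BiasInProbability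

/-! ### From the rounded powers of `p` to growth rates -/

lemma isTheta_of_abs_sub_rpow_le_one {α : ℝ} (hα : 0 < α) {n : ℕ → ℕ}
    (hn : ∀ p : ℕ, |(n p : ℝ) - (p : ℝ) ^ α| ≤ 1) :
    (fun p => (n p : ℝ)) =Θ[atTop] fun p : ℕ => (p : ℝ) ^ α := by
  have rounding : (fun p : ℕ => (n p : ℝ) - (p : ℝ) ^ α) =O[atTop] fun _ => (1 : ℝ) :=
    IsBigO.of_norm_le fun p => by simpa only [Real.norm_eq_abs] using hn p
  have one_isLittleO : (fun _ : ℕ => (1 : ℝ)) =o[atTop] fun p : ℕ => (p : ℝ) ^ α := by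
    simpa only [Real.rpow_zero] using isLittleO_rpow_natCast hα
  exact IsEquivalent.isTheta (rounding.trans_isLittleO one_isLittleO)

lemma eventually_le_of_abs_sub_mul_le_one {c : ℝ} (hc : c < 1) {s : ℕ → ℕ}
    (hs : ∀ p : ℕ, |(s p : ℝ) - c * p| ≤ 1) : ∀ᶠ p in atTop, s p ≤ p := by
  have gap : Tendsto (fun p : ℕ => (1 - c) * (p : ℝ)) atTop atTop :=
    tendsto_natCast_atTop_atTop.const_mul_atTop (sub_pos.2 hc)
  filter_upwards [gap.eventually_ge_atTop 1] with p hp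
  rw [← Nat.cast_le (α := ℝ)]
  linarith [(abs_le.1 (hs p)).2]

lemma eventually_truncation_pos {n : ℕ → ℕ} {σ bn : ℕ → ℝ} (hσ : ∀ p, 0 < σ p)
    (h : Tendsto (fun p => bn p / σ p - √(2 * Real.log (2 * n p))) atTop atTop) :
    ∀ᶠ p in atTop, 0 < bn p := by
  filter_upwards [h.eventually_gt_atTop 0] with p hp
  exact (div_pos_iff_of_pos_right (hσ p)).1 ((Real.sqrt_nonneg _).trans_lt (sub_pos.1 hp))

lemma exists_pos_eventually_le {σ : ℕ → ℝ} (hσ : ∀ p, 0 < σ p)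
    (h : (fun _ => (1 : ℝ)) =O[atTop] σ) : ∃ σ₁ > 0, ∀ᶠ p in atTop, σ₁ ≤ σ p := by
  obtain ⟨c, hc, h⟩ := h.exists_pos
  refine ⟨1 / c, one_div_pos.2 hc, h.bound.mono fun p hp => ?_⟩
  rwa [norm_one, Real.norm_of_nonneg (hσ p).le, ← div_le_iff₀' hc] at hp

lemma exists_projDim_exponent {α γ : ℝ} (hα : 2 < α) (hαγ : 3 < α + γ) :
    ∃ τ, 0 < τ ∧ 2 * τ ≤ α + γ - 3 ∧ 2 + τ < α := by
  have hmin : 0 < min (α + γ - 3) (α - 2) := lt_min (by linarith) (by linarith)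
  have := min_le_left (α + γ - 3) (α - 2)
  have := min_le_right (α + γ - 3) (α - 2)
  exact ⟨min (α + γ - 3) (α - 2) / 2, by linarith, by linarith, by linarith⟩

lemma eventually_privacyW_rowBound_pos (s₀ r : ℕ → ℕ) {b : ℝ} (hb : 0 < b) (bn : ℕ → ℝ) (γ : ℝ)
    {δ : ℕ → ℝ} (hδ : ∀ p, 0 < δ p ∧ δ p < 1) :
    ∀ᶠ p : ℕ in atTop,
      0 < privacyW (rowBound p (s₀ p) b (bn p)) ((p : ℝ) ^ γ) (δ p) (r p) := by
  filter_upwards [eventually_gt_atTop 0] with p hp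
  exact privacyW_pos (rowBound_pos hp _ hb _) (Real.rpow_pos_of_pos (Nat.cast_pos.2 hp) γ)
    (hδ p).1 (hδ p).2 _

end JLDebias

open JLDebias in
theorem mainTheorem6_general {α γ : ℝ} {n s₀ : ℕ → ℕ} {δ : ℕ → ℝ} (hα : 2 < α)
    (hαγ : 3 < α + γ) (hn : (fun p => (n p : ℝ)) =Θ[atTop] fun p : ℕ => (p : ℝ) ^ α)
    (hs : ∀ᶠ p in atTop, s₀ p ≤ p) (hδ : ∀ p, 0 < δ p ∧ δ p < 1)
    (hδO : (fun p => Real.log (1 / δ p)) =O[atTop] fun p : ℕ => Real.log p) :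
    ∃ r : ℕ → ℕ, Tendsto r atTop atTop ∧
      ∀ (C : ℝ) (D : Measure ℝ) (b : ℝ) (σ bn w : ℕ → ℝ), 0 < C →
      (∀ᵐ x ∂D, |x| ≤ b) → ∫ x, x ∂D = 0 → variance id D = 1 →
      (∀ p, 0 < σ p) → (σ =Θ[atTop] fun _ => (1 : ℝ)) →
      (bn =O[atTop] fun p => σ p * √(Real.log (n p))) → (∀ᶠ p in atTop, 0 < bn p) →
      (∀ p : ℕ, w p = privacyW (rowBound p (s₀ p) b (bn p)) ((p : ℝ) ^ γ) (δ p) (r p)) →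
      SufficientConditions C σ n s₀ r w ∧
      ∀ (Ω : ℕ → Type*) [∀ p, MeasurableSpace (Ω p)] (μ : ∀ p, Measure (Ω p))
        [∀ p, IsProbabilityMeasure (μ p)] (X : ∀ p, Ω p → Matrix (Fin (n p)) (Fin p) ℝ)
        (ξ : ∀ p, Ω p → Fin (n p) → ℝ)
        (R : ∀ p, Ω p → Matrix (Fin (r p)) (Fin (n p) ⊕ (Fin p ⊕ Unit)) ℝ)
        (θ₀ : ∀ p, Fin p → ℝ) (θ : ∀ p, Ω p → Fin p → ℝ),
        (∀ᶠ p in atTop, IsModel (μ p) D (σ p) (bn p) (X p) (ξ p) (R p)) →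
        (∀ᶠ p in atTop, ∑ j, θ₀ p j ^ 2 = 1) →
        (∀ᶠ p in atTop, ∀ᵐ ω ∂μ p, IsPrivateLasso (penalty C (σ p) (n p) p (r p)) (w p) (X p ω)
          ((X p ω).mulVec (θ₀ p) + ξ p ω) (R p ω) (θ p ω)) →
        ∀ η : ℝ, 0 < η →
          Tendsto (fun p => μ p {ω | η < ‖bias (w p) (X p ω) (R p ω) (θ₀ p) (θ p ω)‖ /
            (σ p * rho (n p) (r p) (w p))}) atTop (𝓝 0) := by
  obtain ⟨τ, hτ, hτγ, hτα⟩ := exists_projDim_exponent hα hαγ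
  refine ⟨projDim τ, tendsto_projDim hτ, ?_⟩
  intro C D b σ bn w hC hD h₀ h₁ hσ hσΘ hbnO hbn hw
  obtain rfl := funext hw
  obtain ⟨σ₁, hσ₁, hσ⟩ := exists_pos_eventually_le hσ hσΘ.2
  have hbnO := isBigO_truncation hn.1 hσΘ.1 hbnO
  have hr := (tendsto_projDim hτ).eventually_gt_atTop 0
  have hwpos := eventually_privacyW_rowBound_pos s₀ (projDim τ)
    (pos_of_variance_eq_one hD h₁) bn γ hδ
  have hlog := tendsto_mul_log_pow_div_sqrt_projDim hτ
  have hw_sq := tendsto_sqrt_projDim_mul hτ hτγ hn.2 hδ hδO (isBigO_rowBound_sq b hs hbnO)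
  have hwn := tendsto_log_mul_sqrt_mul hwpos hr hlog hw_sq
  have hreg := eventually_regime hC hσ₁ hσ hr (eventually_projDim_le hτ hτα hn.2) hs hwpos hw_sq
  refine ⟨sufficientConditions_of_regime hσ₁ hσ hreg hlog hwn, ?_⟩
  intro Ω _ μ _ X ξ R θ₀ θ hM hθ₀ hθ η hη
  exact tendsto_measure_lt_norm_bias_div hD h₀ h₁ hσ₁ hσ hbn hbnO hreg hlog hwn hM hθ₀ hθ hη

theorem mainTheorem6 :
    -- the absolute constant in the Lasso penalty
    ∃ C : ℝ, 0 < C ∧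
    -- the asymptotic regime, all parameters being functions of `p`
    ∀ (c₀ α γ : ℝ) (n s₀ : ℕ → ℕ) (δ : ℕ → ℝ),
      0 < c₀ → c₀ < 1 → 2 < α → 3 < α + γ →
      (∀ p : ℕ, |(n p : ℝ) - (p : ℝ) ^ α| ≤ 1) →
      (∀ p : ℕ, |(s₀ p : ℝ) - c₀ * p| ≤ 1) →
      (∀ p : ℕ, 0 < δ p ∧ δ p < 1) →
      ((fun p : ℕ => Real.log (1 / δ p)) =O[atTop] fun p : ℕ => Real.log p) →
    -- the projection dimension
    ∃ r : ℕ → ℕ, Tendsto r atTop atTop ∧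
    -- the entry distribution, the noise level and truncation, and the privacy parameter
    ∀ (D : Measure ℝ) (b : ℝ) (σ bn w : ℕ → ℝ),
      IsProbabilityMeasure D →
      (∀ᵐ x ∂D, |x| ≤ b) → ∫ x, x ∂D = 0 → ProbabilityTheory.variance id D = 1 →
      (∀ p : ℕ, 0 < σ p) → (σ =Θ[atTop] fun _ => (1 : ℝ)) →
      (bn =O[atTop] fun p : ℕ => σ p * √(Real.log (n p))) →
      Tendsto (fun p : ℕ => bn p / σ p - √(2 * Real.log (2 * n p))) atTop atTop →
      (∀ p : ℕ, w p =
        JLDebias.privacyW (JLDebias.rowBound p (s₀ p) b (bn p)) ((p : ℝ) ^ γ) (δ p) (r p)) →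
    JLDebias.SufficientConditions C σ n s₀ r w ∧
    -- the linear model, the projection and the private Lasso
    ∀ (Ω : ℕ → Type*) [∀ p, MeasurableSpace (Ω p)] (μ : ∀ p, Measure (Ω p))
      [∀ p, IsProbabilityMeasure (μ p)]
      (X : ∀ p, Ω p → Matrix (Fin (n p)) (Fin p) ℝ)
      (ξ : ∀ p, Ω p → Fin (n p) → ℝ)
      (R : ∀ p, Ω p → Matrix (Fin (r p)) (Fin (n p) ⊕ (Fin p ⊕ Unit)) ℝ)
      (θ₀ : ∀ p : ℕ, Fin p → ℝ) (y : ∀ p, Ω p → Fin (n p) → ℝ)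
      (θhat : ∀ p, Ω p → Fin p → ℝ),
      (∀ᶠ p in atTop, JLDebias.IsModel (μ p) D (σ p) (bn p) (X p) (ξ p) (R p)) →
      (∀ᶠ p in atTop, ∑ j, θ₀ p j ^ 2 = 1) →
      (∀ᶠ p in atTop, {j | θ₀ p j ≠ 0}.ncard = s₀ p) →
      (∀ p ω, y p ω = (X p ω).mulVec (θ₀ p) + ξ p ω) →
      (∀ᶠ p in atTop, ∀ᵐ ω ∂(μ p), JLDebias.IsPrivateLasso
        (JLDebias.penalty C (σ p) (n p) p (r p)) (w p) (X p ω) (y p ω) (R p ω) (θhat p ω)) →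
      -- the sup norm of the bias is of smaller order, in probability, than `σ ρ`
      ∀ η : ℝ, 0 < η →
        Tendsto (fun p : ℕ => μ p {ω |
            η < ‖JLDebias.bias (w p) (X p ω) (R p ω) (θ₀ p) (θhat p ω)‖ /
              (σ p * JLDebias.rho (n p) (r p) (w p))})
          atTop (𝓝 0) := by
  refine ⟨1, one_pos, fun c₀ α γ n s₀ δ _ hc₀ hα hαγ hn hs hδ hδO => ?_⟩
  obtain ⟨r, hr, h⟩ := mainTheorem6_general hα hαγ
    (JLDebias.isTheta_of_abs_sub_rpow_le_one (by linarith) hn)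
    (JLDebias.eventually_le_of_abs_sub_mul_le_one hc₀ hs) hδ hδO
  refine ⟨r, hr, fun D b σ bn w _ hD h₀ h₁ hσ hσΘ hbnO hbn hw => ?_⟩
  obtain ⟨hcond, hbias⟩ := h 1 D b σ bn w one_pos hD h₀ h₁ hσ hσΘ hbnO
    (JLDebias.eventually_truncation_pos hσ hbn) hw
  refine ⟨hcond, fun Ω _ μ _ X ξ R θ₀ y θhat hM hθ₀ _ hy hθ => ?_⟩
  obtain rfl : y = fun p ω => (X p ω).mulVec (θ₀ p) + ξ p ω := funext₂ hy
  exact hbias Ω μ X ξ R θ₀ θhat hM hθ₀ hθ
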